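/- Let \(M\) be a connected smooth manifold of dimension \(m\ge 1\) with a smooth metric tensor \(g\) that is non-degenerate but not necessarily definite. Let \(\mathrm{Cl}(g)=\bigcup_{x\in M}\mathrm{Cl}(g_x)\) be its bundle of real Clifford algebras (with \(v^2=g_x(v,v)\) for \(v\in T_xM\)), and let \(\mathrm{Cl}^0(g)\) be the subbundle of even subalgebras. Let \(\tau:\mathrm{Cl}(g)\to\mathrm{End}\,\Sigma\) be a spinor bundle on \(M\). That is, \(\Sigma\to M\) is a smooth complex vector bundle, \(\tau\) is a smooth homomorphism of bundles of real unital algebras, and for every \(x\in M\) the representation \(\tau_x\) of \(\mathrm{Cl}(g_x)\) in the complex vector space \(\Sigma_x\) is of the following type (up to complex-linear equivalence). - If \(m=2n\) is even, \(\tau_x\) is the Dirac representation: the faithful irreducible representation, of complex dimension \(2^n\). - If \(m=2n-1\) is odd, \(\tau_x\) is the Cartan representation \(\sigma\oplus(\sigma\circ\alpha)\), of complex dimension \(2^n\). Here \(\sigma\) is a Pauli representation, i.e. an extension to \(\mathrm{Cl}(g_x)\) of the faithful irreducible representation of \(\mathrm{Cl}^0(g_x)\) in a complex space of dimension \(2^{n-1}\),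 and \(\alpha\) is the grading automorphism, \(\alpha(v)=-v\) for \(v\in T_xM\). Let \(\tau^{\mathrm d}\) be the restriction of \(\tau\) to \(\mathrm{Cl}^{\mathrm d}(g)\), where \(\mathrm{Cl}^{\mathrm d}(g)=\mathrm{Cl}(g)\) if \(m\) is odd and \(\mathrm{Cl}^{\mathrm d}(g)=\mathrm{Cl}^0(g)\) if \(m\) is even. Call \(\tau^{\mathrm d}\) decomposable if there are smooth complex subbundles \(\Sigma_+,\Sigma_-\subset\Sigma\) of positive rank such that \(\Sigma=\Sigma_+\oplus\Sigma_-\) and \(\tau(\mathrm{Cl}^{\mathrm d}(g_x))\,\Sigma_{\pm,x}\subset\Sigma_{\pm,x}\) for every \(x\in M\). Theorem. \(\tau^{\mathrm d}\) is decomposable if and only if \(M\) is orientable. -/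

import Mathlib

open Set Bundle Module
open scoped Manifold ContDiff

noncomputable section

/-! ### Spinor representations of Clifford algebras -/

section Representations

variable {A : Type*} [Ring A] [Algebra ℝ A]
  {S : Type*} [AddCommGroup S] [Module ℂ S] {S' : Type*} [AddCommGroup S'] [Module ℂ S']

/-- A representation of a real algebra in a complex vector space is irreducible if the space is
nonzero and the only invariant complex subspaces are the trivial ones. -/
def IsIrreducibleRep (ρ : A →ₐ[ℝ] Module.End ℂ S) : Prop :=
  Nontrivial S ∧
    ∀ W : Submodule ℂ S, (∀ a : A, ∀ s ∈ W, ρ a s ∈ W) → W = ⊥ ∨ W = ⊤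

/-- Complex equivalence of two representations of a real algebra in complex vector spaces. -/
def RepEquivalent (ρ : A →ₐ[ℝ] Module.End ℂ S) (ρ' : A →ₐ[ℝ] Module.End ℂ S') : Prop :=
  ∃ φ : S ≃ₗ[ℂ] S', ∀ (a : A) (s : S), φ (ρ a s) = ρ' a (φ s)

variable {V : Type*} [AddCommGroup V] [Module ℝ V] {Q : QuadraticForm ℝ V}

/-- Dirac representation (for `dim V` even): the faithful irreducible representation of `Cl(Q)` in
a complex vector space of dimension `2 ^ (dim V / 2)`. -/
def IsDiracRep (ρ : CliffordAlgebra Q →ₐ[ℝ] Module.End ℂ S) : Prop :=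
  Function.Injective ρ ∧ IsIrreducibleRep ρ ∧ finrank ℂ S = 2 ^ (finrank ℝ V / 2)

/-- Pauli representation (for `dim V` odd): a representation `σ` of `Cl(Q)` in a complex vector
space of dimension `2 ^ ((dim V - 1) / 2)` extending the faithful irreducible representation of
the even subalgebra. (By Schur's lemma `σ` then maps a volume element `η` to one of the two
scalars whose square is `η ^ 2`; the two choices are exchanged by replacing `σ` by `σ ∘ α`.) -/
def IsPauliRep (σ : CliffordAlgebra Q →ₐ[ℝ] Module.End ℂ S) : Prop :=
  Function.Injective (σ.comp (CliffordAlgebra.even Q).val) ∧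
    IsIrreducibleRep (σ.comp (CliffordAlgebra.even Q).val) ∧
    finrank ℂ S = 2 ^ (finrank ℝ V / 2)

/-- The representation `σ ⊕ σ ∘ α` of `Cl(Q)` in `S ⊕ S`, with `α` the grading automorphism. -/
def cartanRep (σ : CliffordAlgebra Q →ₐ[ℝ] Module.End ℂ S) :
    CliffordAlgebra Q →ₐ[ℝ] Module.End ℂ (S × S) :=
  ((LinearMap.prodMapAlgHom ℂ S S).restrictScalars ℝ).comp
    (σ.prod (σ.comp (CliffordAlgebra.involute (Q := Q))))

theorem cartanRep_apply (σ : CliffordAlgebra Q →ₐ[ℝ] Module.End ℂ S) (a : CliffordAlgebra Q)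
    (s t : S) :
    cartanRep σ a (s, t) = (σ a s, σ (CliffordAlgebra.involute a) t) := rfl

/-- Cartan representation (for `dim V` odd): one that is equivalent to `σ ⊕ σ ∘ α` for a Pauli
representation `σ`. -/
def IsCartanRep (ρ : CliffordAlgebra Q →ₐ[ℝ] Module.End ℂ S) : Prop :=
  ∃ σ : CliffordAlgebra Q →ₐ[ℝ] Module.End ℂ (Fin (2 ^ (finrank ℝ V / 2)) → ℂ),
    IsPauliRep σ ∧ RepEquivalent ρ (cartanRep σ)

end Representations

/-! ### Manifolds: orientability, metrics -/

section Manifold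

variable (m : ℕ) (M : Type*) [TopologicalSpace M] [ChartedSpace (EuclideanSpace ℝ (Fin m)) M]

/-- A smooth manifold is orientable if it is covered by charts of its maximal smooth atlas whose
transition maps all have positive Jacobian determinant. -/
def IsOrientableManifold : Prop :=
  ∃ A : Set (OpenPartialHomeomorph M (EuclideanSpace ℝ (Fin m))),
    A ⊆ IsManifold.maximalAtlas (𝓡 m) ∞ M ∧
    (∀ x : M, ∃ e ∈ A, x ∈ e.source) ∧
    ∀ e ∈ A, ∀ e' ∈ A, ∀ y ∈ (e.symm.trans e').source,
      0 < (fderiv ℝ (e.symm.trans e') y).det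

variable [IsManifold (𝓡 m) ∞ M]

/-- A smooth pseudo-Riemannian metric (nondegenerate, not necessarily definite). -/
structure PseudoRiemannianMetric where
  inner (x : M) : TangentSpace (𝓡 m) x →L[ℝ] TangentSpace (𝓡 m) x →L[ℝ] ℝ
  symm (x : M) (v w : TangentSpace (𝓡 m) x) : inner x v w = inner x w v
  nondegenerate (x : M) (v : TangentSpace (𝓡 m) x) (hv : ∀ w, inner x v w = 0) : v = 0
  contMDiff : ContMDiff (𝓡 m)
    ((𝓡 m).prod 𝓘(ℝ, EuclideanSpace ℝ (Fin m) →L[ℝ] EuclideanSpace ℝ (Fin m) →L[ℝ] ℝ)) ∞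
    (fun x ↦ TotalSpace.mk' (EuclideanSpace ℝ (Fin m) →L[ℝ] EuclideanSpace ℝ (Fin m) →L[ℝ] ℝ)
      x (inner x))

variable {m M}

/-- The quadratic form `v ↦ g_x(v, v)` on the tangent space at `x`. -/
def PseudoRiemannianMetric.quadraticForm (g : PseudoRiemannianMetric m M) (x : M) :
    QuadraticForm ℝ (TangentSpace (𝓡 m) x) :=
  LinearMap.BilinMap.toQuadraticMap
    (LinearMap.mk₂ ℝ (fun v w : TangentSpace (𝓡 m) x ↦ g.inner x v w)
      (by intros; simp) (by intros; simp) (by intros; simp) (by intros; simp))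

theorem PseudoRiemannianMetric.quadraticForm_apply (g : PseudoRiemannianMetric m M) (x : M)
    (v : TangentSpace (𝓡 m) x) : g.quadraticForm x v = g.inner x v v := rfl

/-- The fibre `Cl(g_x)` of the Clifford bundle, in which `v ^ 2 = g_x(v, v)`. -/
abbrev PseudoRiemannianMetric.Cl (g : PseudoRiemannianMetric m M) (x : M) :=
  CliffordAlgebra (g.quadraticForm x)

/-- The fibre at `x` of the bundle of algebras `Cl^d(g)`: all of `Cl(g_x)` if `m` is odd, the even
subalgebra if `m` is even. -/
def PseudoRiemannianMetric.ClD (g : PseudoRiemannianMetric m M) (x : M) :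
    Subalgebra ℝ (g.Cl x) :=
  if Odd m then ⊤ else CliffordAlgebra.even (g.quadraticForm x)

/-! ### Complex vector bundles with Clifford action -/

variable (F : Type*) [NormedAddCommGroup F] [NormedSpace ℂ F]
  (E : M → Type*) [∀ x, AddCommGroup (E x)] [∀ x, Module ℂ (E x)]
  [∀ x, TopologicalSpace (E x)] [TopologicalSpace (TotalSpace F E)] [FiberBundle F E]

variable (m) {E} in
/-- A (possibly only locally meaningful) section `s` of the bundle `E` is smooth on `U`. -/
def IsSmoothSectionOn (s : ∀ x, E x) (U : Set M) : Prop :=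
  ContMDiffOn (𝓡 m) ((𝓡 m).prod 𝓘(ℝ, F)) ∞ (fun x ↦ TotalSpace.mk' F x (s x)) U

/-- A vector field `X` is smooth on `U`. -/
def IsSmoothVectorFieldOn (X : ∀ x : M, TangentSpace (𝓡 m) x) (U : Set M) : Prop :=
  ContMDiffOn (𝓡 m) (𝓡 m).tangent ∞
    (fun x ↦ (TotalSpace.mk' (EuclideanSpace ℝ (Fin m)) x (X x) : TangentBundle (𝓡 m) M)) U

variable (m) in
/-- A family `W x ⊆ E x` of complex subspaces is a smooth complex subbundle of rank `r` if it is
locally spanned by `r` smooth sections that are pointwise linearly independent. -/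
def IsSmoothSubbundle (r : ℕ) (W : ∀ x, Submodule ℂ (E x)) : Prop :=
  ∀ x₀ : M, ∃ U : Set M, IsOpen U ∧ x₀ ∈ U ∧ ∃ s : Fin r → ∀ x, E x,
    (∀ i, IsSmoothSectionOn m F (s i) U) ∧
    ∀ x ∈ U, LinearIndependent ℂ (fun i ↦ s i x) ∧
      Submodule.span ℂ (Set.range fun i ↦ s i x) = W x

variable (m) in
/-- A fibrewise representation `ρ` of a family of real algebras `A x` on the vector bundle `E` is
decomposable if `E` is the direct sum of two smooth subbundles of positive rank that are
invariant under `ρ`. -/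
def IsDecomposable {A : M → Type*} [∀ x, Ring (A x)] [∀ x, Algebra ℝ (A x)]
    (ρ : ∀ x, A x →ₐ[ℝ] Module.End ℂ (E x)) : Prop :=
  ∃ (p q : ℕ) (Wp Wm : ∀ x, Submodule ℂ (E x)), 0 < p ∧ 0 < q ∧
    IsSmoothSubbundle m F E p Wp ∧ IsSmoothSubbundle m F E q Wm ∧
    (∀ x, IsCompl (Wp x) (Wm x)) ∧
    (∀ x (a : A x), ∀ s ∈ Wp x, ρ x a s ∈ Wp x) ∧
    (∀ x (a : A x), ∀ s ∈ Wm x, ρ x a s ∈ Wm x)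

/-- A homomorphism of bundles of algebras `τ : Cl(g) → End E`. Since `Cl(g)` is generated by `TM`,
it is smooth if and only if it is smooth on `TM`, that is, if it takes local smooth vector fields
`X` and local smooth sections `s` to local smooth sections `τ(X) s`. -/
structure CliffordModuleStructure (g : PseudoRiemannianMetric m M) where
  hom (x : M) : g.Cl x →ₐ[ℝ] Module.End ℂ (E x)
  smooth (U : Set M) (hU : IsOpen U) (X : ∀ x : M, TangentSpace (𝓡 m) x) (s : ∀ x, E x)
    (hX : IsSmoothVectorFieldOn X U) (hs : IsSmoothSectionOn m F s U) :
    IsSmoothSectionOn m F (fun x ↦ hom x (CliffordAlgebra.ι (g.quadraticForm x) (X x)) (s x)) U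

variable {F E} {g : PseudoRiemannianMetric m M}

/-- A bundle of Clifford modules is a spinor bundle if all the representations `τ_x` are Dirac
representations (`m` even), respectively Cartan representations (`m` odd). -/
def CliffordModuleStructure.IsSpinorBundle (τ : CliffordModuleStructure F E g) : Prop :=
  ∀ x, (Even m → IsDiracRep (τ.hom x)) ∧ (Odd m → IsCartanRep (τ.hom x))

/-- The restriction `τ^d` of `τ` to `Cl^d(g)`. -/
def CliffordModuleStructure.homD (τ : CliffordModuleStructure F E g) (x : M) :
    g.ClD x →ₐ[ℝ] Module.End ℂ (E x) :=
  (τ.hom x).comp (g.ClD x).val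

end Manifold

end

/-! The proof turns on the volume element η of the Clifford algebra: for a chart `e`, the
antisymmetrized product of its coordinate vectors (`chartVolume`). Being alternating of top degree
in the frame, it is multiplied by the Jacobian determinant under a change of chart
(`chartVolume_eq_det_smul`). It is also a nonzero multiple of the product of any orthogonal basis.
Hence η² is a nonzero real number, and η commutes with Cl^d: it is central for odd m, and
anticommutes with vectors for even m.

The eigenspaces of τ(η) for the two square roots of η² are therefore invariant under Cl^d, and each
has half the dimension. Conversely, η acts as a scalar on every invariant subspace other than 0 and
the whole fibre (`IsDiracRep.cliffordVolume_eigenspaces`, `IsCartanRep.cliffordVolume_eigenspaces`).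
In the Dirac case a proper nonzero even-invariant subspace has half the dimension, because a
non-null vector carries it to a complement. In the Cartan case η acts by opposite scalars on the two
Pauli summands, each already irreducible under the even subalgebra.

Given a decomposition, η acts on Σ₊ by a scalar whose square is real and nonzero. The sum of its
real and imaginary parts is a continuous nonvanishing real function on the chart domain that changes
by the Jacobian determinant. The charts on which it is positive form an oriented atlas. Given an
oriented atlas, a choice of square root compatible with positive rescaling makes the two eigenspaces
independent of the chart, and they are smooth because the eigenprojections are. -/

noncomputable section

/-! ### The volume element of a Clifford algebra -/

section Volume

/-- A product of pairwise anticommuting elements changes by the sign when it is permuted. -/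
theorem prod_ofFn_comp_perm {A : Type*} [Ring A] {n : ℕ} (a : Fin n → A)
    (ha : Pairwise fun i j ↦ a i * a j = -(a j * a i)) (σ : Equiv.Perm (Fin n)) :
    (List.ofFn fun i ↦ a (σ i)).prod = Equiv.Perm.sign σ • (List.ofFn a).prod := by
  -- Adjacent transpositions generate the symmetric group, so one sign flip is all that needs
  -- checking. The induction peels off leading factors until the swapped pair stands in front.
  have swap_case : ∀ (k : ℕ) (i : Fin k) (a : Fin (k + 1) → A),
      (Pairwise fun i j ↦ a i * a j = -(a j * a i)) →
      (List.ofFn fun j ↦ a (Equiv.swap i.castSucc i.succ j)).prod = -(List.ofFn a).prod := by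
    intro k
    induction k with
    | zero => exact fun i ↦ i.elim0
    | succ k ih =>
      intro i a ha
      refine Fin.cases ?_ (fun j ↦ ?_) i
      · have h2 : ∀ j : Fin k, Equiv.swap (0 : Fin (k + 2)) 1 j.succ.succ = j.succ.succ :=
          fun j ↦ Equiv.swap_apply_of_ne_of_ne (Fin.succ_ne_zero _)
            (by simp [Fin.ext_iff])
        have h01 := ha (i := 0) (j := 1) (by simp)
        simp only [List.ofFn_succ, List.prod_cons, Fin.castSucc_zero, Fin.succ_zero_eq_one,
          Equiv.swap_apply_left, Equiv.swap_apply_right, h2]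
        rw [← mul_assoc, ← mul_assoc, h01, neg_mul, neg_neg]
      · have h0 : Equiv.swap j.succ.castSucc j.succ.succ (0 : Fin (k + 2)) = 0 :=
          Equiv.swap_apply_of_ne_of_ne (by simp [Fin.ext_iff]) (Fin.succ_ne_zero _).symm
        have hs : ∀ l : Fin (k + 1), Equiv.swap j.succ.castSucc j.succ.succ l.succ =
            (Equiv.swap j.castSucc j.succ l).succ := fun l ↦ by
          rw [← Fin.succ_castSucc]
          exact ((Fin.succ_injective _).swap_apply _ _ _)
        rw [List.ofFn_succ, List.prod_cons, List.ofFn_succ (f := a), List.prod_cons]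
        simp only [h0, hs]
        have := ih j (fun l ↦ a l.succ) (fun x y hxy ↦ ha (by simpa using hxy))
        simp only [this, mul_neg]
  cases n with
  | zero => simp [Subsingleton.elim σ 1]
  | succ n =>
    have hσ : σ ∈ Submonoid.closure
        (Set.range fun i : Fin n ↦ Equiv.swap i.castSucc i.succ) := by
      rw [Equiv.Perm.mclosure_swap_castSucc_succ]; trivial
    induction hσ using Submonoid.closure_induction generalizing a with
    | mem x hx =>
      obtain ⟨i, rfl⟩ := hx
      rw [swap_case n i a ha, Equiv.Perm.sign_swap i.castSucc_lt_succ.ne, Units.neg_smul, one_smul]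
    | one => simp
    | mul x y _ _ hx hy =>
      have := hy (fun i ↦ a (x i)) (fun i j hij ↦ ha (x.injective.ne hij))
      simp only [Equiv.Perm.coe_mul, Function.comp_apply, this, hx a ha, map_mul, smul_smul]
      rw [mul_comm]

/-- An element that anticommutes with all factors of a product but one, with which it commutes. -/
theorem mul_prod_ofFn_of_anticomm {A : Type*} [Ring A] {n : ℕ} (a : Fin n → A)
    (ha : Pairwise fun i j ↦ a i * a j = -(a j * a i)) (i : Fin n) :
    a i * (List.ofFn a).prod = (-1) ^ (n - 1) * ((List.ofFn a).prod * a i) := by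
  have key : ∀ (x : A) (L : List A), (∀ y ∈ L, x * y = -(y * x)) →
      x * L.prod = (-1) ^ L.length * (L.prod * x) := by
    intro x L
    induction L with
    | nil => simp
    | cons y L ih =>
      intro h
      have h1 := ih fun z hz ↦ h z (List.mem_cons_of_mem _ hz)
      have hc : Commute ((-1 : A) ^ L.length) y := (Commute.neg_one_left y).pow_left _
      rw [List.prod_cons, ← mul_assoc, h y List.mem_cons_self, neg_mul, mul_assoc y x, h1,
        ← mul_assoc y, ← hc.eq, List.length_cons, pow_succ]
      noncomm_ring
  -- Moving `a i` across the product costs a sign for each of the `i` factors before it and the `n -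
  -- (i + 1)` after it, and none for its own copy.
  have hsplit : List.ofFn a = (List.ofFn a).take i ++ a i :: (List.ofFn a).drop (i + 1) := by
    have := List.take_append_drop i (List.ofFn a)
    rw [List.drop_eq_getElem_cons (by simp)] at this
    simpa using this.symm
  have h1 := key (a i) ((List.ofFn a).take i) fun y hy ↦ by
    obtain ⟨k, hk, rfl⟩ := List.mem_take_iff_getElem.1 hy
    simp only [List.getElem_ofFn]
    refine ha fun h ↦ ?_
    have := congrArg Fin.val h
    simp at this hk
    omega
  have h2 := key (a i) ((List.ofFn a).drop (i + 1)) fun y hy ↦ by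
    obtain ⟨k, hk, rfl⟩ := List.mem_drop_iff_getElem.1 hy
    simp only [List.getElem_ofFn]
    refine ha fun h ↦ ?_
    have := congrArg Fin.val h
    simp at this
    omega
  rw [hsplit, List.prod_append, List.prod_cons]
  set P := ((List.ofFn a).take i).prod
  set R := ((List.ofFn a).drop (i + 1)).prod
  have hl1 : ((List.ofFn a).take i).length = i := by simp
  have hl2 : ((List.ofFn a).drop (i + 1)).length = n - (i + 1) := by simp
  rw [hl1] at h1
  rw [hl2] at h2
  have hc : ∀ (k : ℕ) (y : A), (-1 : A) ^ k * y = y * (-1) ^ k :=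
    fun k y ↦ ((Commute.neg_one_left y).pow_left k).eq
  rw [show n - 1 = i + (n - (i + 1)) by omega, pow_add]
  calc a i * (P * (a i * R)) = (a i * P) * (a i * R) := by rw [mul_assoc]
    _ = (-1) ^ (i : ℕ) * P * a i * (a i * R) := by rw [h1]; simp only [mul_assoc]
    _ = (-1) ^ (i : ℕ) * P * a i * ((-1) ^ (n - (i + 1)) * (R * a i)) := by rw [h2]
    _ = _ := by
      rw [mul_assoc ((-1) ^ (i : ℕ) * P), ← mul_assoc (a i) ((-1) ^ (n - (i + 1))), ← hc]
      rw [mul_assoc ((-1) ^ (i : ℕ)) P, ← mul_assoc P, ← mul_assoc P, ← hc]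
      simp only [mul_assoc]

/-- An alternating map of top degree is determined by its value on a basis. -/
theorem AlternatingMap.apply_eq_det_smul {R M N ι : Type*} [CommRing R] [AddCommGroup M]
    [Module R M] [AddCommGroup N] [Module R N] [DecidableEq ι] [Fintype ι] (e : Basis ι R M)
    (f : M [⋀^ι]→ₗ[R] N) (v : ι → M) : f v = e.det v • f e := by
  have : f = (LinearMap.toSpanSingleton R N (f e)).compAlternatingMap e.det := by
    apply Basis.ext_alternating e
    intro i hi
    let σ : Equiv.Perm ι := Equiv.ofBijective i (Finite.injective_iff_bijective.1 hi)
    change f (e ∘ σ) = e.det (e ∘ σ) • f e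
    simp [AlternatingMap.map_perm, Basis.det_self]
  conv_lhs => rw [this]
  simp

variable {V : Type*} [AddCommGroup V] [Module ℝ V] (Q : QuadraticForm ℝ V)

/-- The antisymmetrized product of `n` vectors in the Clifford algebra. -/
def cliffordVolume (n : ℕ) : V [⋀^Fin n]→ₗ[ℝ] CliffordAlgebra Q :=
  MultilinearMap.alternatization
    ((MultilinearMap.mkPiAlgebraFin ℝ n (CliffordAlgebra Q)).compLinearMap
      fun _ ↦ CliffordAlgebra.ι Q)

theorem cliffordVolume_apply {n : ℕ} (v : Fin n → V) :
    cliffordVolume Q n v = ∑ σ : Equiv.Perm (Fin n),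
      Equiv.Perm.sign σ • (List.ofFn fun i ↦ CliffordAlgebra.ι Q (v (σ i))).prod := by
  simp [cliffordVolume, MultilinearMap.alternatization_apply]

variable {Q}

/-- Orthogonal vectors anticommute, so the sign from reordering cancels the sign in the
antisymmetrization and all `n!` terms agree. -/
theorem cliffordVolume_of_isOrtho {n : ℕ} {v : Fin n → V}
    (hv : Pairwise fun i j ↦ Q.IsOrtho (v i) (v j)) :
    cliffordVolume Q n v =
      (n.factorial : ℝ) • (List.ofFn fun i ↦ CliffordAlgebra.ι Q (v i)).prod := by
  have h := prod_ofFn_comp_perm (fun i ↦ CliffordAlgebra.ι Q (v i))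
    fun i j hij ↦ CliffordAlgebra.ι_mul_ι_comm_of_isOrtho (hv hij)
  rw [cliffordVolume_apply]
  simp only [h, smul_smul, Int.units_mul_self, one_smul, Finset.sum_const, Finset.card_univ,
    Fintype.card_perm, Fintype.card_fin]
  rw [Nat.cast_smul_eq_nsmul]

theorem exists_orthogonal_basis_of_separatingLeft {n : ℕ} (b : Basis (Fin n) ℝ V)
    (hQ : (QuadraticMap.associated (R := ℝ) Q).SeparatingLeft) :
    ∃ e : Basis (Fin n) ℝ V, (Pairwise fun i j ↦ Q.IsOrtho (e i) (e j)) ∧ ∀ i, Q (e i) ≠ 0 := by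
  have : FiniteDimensional ℝ V := b.finiteDimensional_of_finite
  have hn : finrank ℝ V = n := by simpa using finrank_eq_card_basis b
  subst hn
  obtain ⟨e, he⟩ := LinearMap.BilinForm.exists_orthogonal_basis
    (B := QuadraticMap.associated (R := ℝ) Q) ⟨QuadraticMap.associated_isSymm ℝ Q⟩
  refine ⟨e, fun i j hij ↦ ?_, fun i ↦ ?_⟩
  · have := he hij
    exact QuadraticMap.associated_isOrtho.1 this
  · have := he.not_isOrtho_basis_self_of_separatingLeft hQ i
    rwa [QuadraticMap.associated_eq_self_apply] at this

/-- A change of basis only rescales the volume, so an orthogonal basis may be used. There the square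
is, up to a nonzero factor, the product of the values of `Q`, none of which vanishes. -/
theorem cliffordVolume_mul_self {n : ℕ} (b : Basis (Fin n) ℝ V)
    (hQ : (QuadraticMap.associated (R := ℝ) Q).SeparatingLeft) :
    ∃ r : ℝ, r ≠ 0 ∧ cliffordVolume Q n b * cliffordVolume Q n b = algebraMap ℝ _ r := by
  obtain ⟨e, he, hne⟩ := exists_orthogonal_basis_of_separatingLeft b hQ
  have hdet : e.det b ≠ 0 := (Basis.isUnit_det e b).ne_zero
  set P := (List.ofFn fun i ↦ CliffordAlgebra.ι Q (e i)).prod with hP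
  -- A product times its reversal collapses from the middle outwards. Reversal is a permutation, so
  -- for orthogonal vectors it can be undone at the price of a sign.
  have key : ∀ l : List V, (l.map (CliffordAlgebra.ι Q)).prod *
      (l.map (CliffordAlgebra.ι Q)).reverse.prod = algebraMap ℝ _ (l.map Q).prod := by
    intro l
    induction l with
    | nil => simp
    | cons v l ih =>
      simp only [List.map_cons, List.prod_cons, List.reverse_cons, List.prod_append,
        List.prod_nil, mul_one, map_mul]
      rw [mul_assoc, ← mul_assoc _ _ (CliffordAlgebra.ι Q v), ih, Algebra.commutes,
        ← mul_assoc, CliffordAlgebra.ι_sq_scalar]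
  have hrev : (List.ofFn fun i ↦ CliffordAlgebra.ι Q (e i)).reverse.prod =
      Equiv.Perm.sign (Fin.revPerm : Equiv.Perm (Fin n)) • P := by
    rw [hP, ← prod_ofFn_comp_perm (fun i ↦ CliffordAlgebra.ι Q (e i))
      (fun i j hij ↦ CliffordAlgebra.ι_mul_ι_comm_of_isOrtho (he hij)) Fin.revPerm]
    congr 1
    apply List.ext_getElem <;> simp [Fin.rev, Nat.sub_sub, add_comm]
  have hPP : P * P = algebraMap ℝ _
      (((Equiv.Perm.sign (Fin.revPerm : Equiv.Perm (Fin n)) : ℤ) : ℝ) *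
        (List.ofFn fun i ↦ Q (e i)).prod) := by
    have h := key (List.ofFn e)
    simp only [List.map_ofFn, Function.comp_def] at h
    rw [hrev, mul_smul_comm] at h
    rw [map_mul, ← h]
    rcases Int.units_eq_one_or (Equiv.Perm.sign (Fin.revPerm : Equiv.Perm (Fin n))) with h | h <;>
      simp [h, ← hP]
  refine ⟨(e.det b * n.factorial) * (e.det b * n.factorial) *
    (((Equiv.Perm.sign (Fin.revPerm : Equiv.Perm (Fin n)) : ℤ) : ℝ) *
        (List.ofFn fun i ↦ Q (e i)).prod), ?_, ?_⟩
  · have hf : (n.factorial : ℝ) ≠ 0 := by exact_mod_cast n.factorial_ne_zero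
    have hp : (List.ofFn fun i ↦ Q (e i)).prod ≠ 0 := by
      rw [List.prod_ofFn]
      exact Finset.prod_ne_zero_iff.2 fun i _ ↦ hne i
    have hs : ((Equiv.Perm.sign (Fin.revPerm : Equiv.Perm (Fin n)) : ℤ) : ℝ) ≠ 0 := by
      exact_mod_cast (Equiv.Perm.sign (Fin.revPerm : Equiv.Perm (Fin n))).ne_zero
    positivity
  · rw [AlternatingMap.apply_eq_det_smul e (cliffordVolume Q n) b, cliffordVolume_of_isOrtho he,
      smul_smul, smul_mul_smul_comm, hPP, Algebra.smul_def, ← map_mul]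

/-- Both sides are linear in `v`, so it suffices to take `v` in an orthogonal basis, where it
anticommutes with all factors of the volume but one. -/
theorem ι_mul_cliffordVolume {n : ℕ} (b : Basis (Fin n) ℝ V)
    (hQ : (QuadraticMap.associated (R := ℝ) Q).SeparatingLeft) (v : V) :
    CliffordAlgebra.ι Q v * cliffordVolume Q n b =
      (-1) ^ (n - 1) * (cliffordVolume Q n b * CliffordAlgebra.ι Q v) := by
  obtain ⟨e, he, -⟩ := exists_orthogonal_basis_of_separatingLeft b hQ
  set η := cliffordVolume Q n b with hη
  have : (LinearMap.mulRight ℝ η).comp (CliffordAlgebra.ι Q) =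
      (LinearMap.mulLeft ℝ ((-1) ^ (n - 1) * η)).comp (CliffordAlgebra.ι Q) := by
    refine e.ext fun i ↦ ?_
    have h := mul_prod_ofFn_of_anticomm (fun i ↦ CliffordAlgebra.ι Q (e i))
      (fun i j hij ↦ CliffordAlgebra.ι_mul_ι_comm_of_isOrtho (he hij)) i
    simp only [LinearMap.comp_apply, LinearMap.mulRight_apply, LinearMap.mulLeft_apply]
    rw [hη, AlternatingMap.apply_eq_det_smul e (cliffordVolume Q n) b,
      cliffordVolume_of_isOrtho he, smul_smul, mul_smul_comm, h, mul_smul_comm, smul_mul_assoc,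
      mul_assoc]
  have := LinearMap.congr_fun this v
  simpa [mul_assoc] using this

theorem cliffordVolume_mem_evenOdd {n : ℕ} (v : Fin n → V) :
    cliffordVolume Q n v ∈ CliffordAlgebra.evenOdd Q n := by
  rw [cliffordVolume_apply]
  refine Submodule.sum_mem _ fun σ _ ↦ ?_
  have h : (List.ofFn fun i ↦ CliffordAlgebra.ι Q (v (σ i))).prod ∈
      CliffordAlgebra.evenOdd Q n := by
    have := SetLike.list_prod_ofFn_mem_graded (A := CliffordAlgebra.evenOdd Q)
      (fun _ : Fin n ↦ 1) (fun i ↦ CliffordAlgebra.ι Q (v (σ i)))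
      fun i ↦ CliffordAlgebra.ι_mem_evenOdd_one Q _
    simpa using this
  rcases Int.units_eq_one_or (Equiv.Perm.sign σ) with hs | hs
  · simpa [hs] using h
  · simpa [hs, Units.neg_smul] using h

theorem cliffordVolume_mem_even {n : ℕ} (hn : Even n) (v : Fin n → V) :
    cliffordVolume Q n v ∈ CliffordAlgebra.even Q := by
  have := cliffordVolume_mem_evenOdd (Q := Q) v
  rw [(ZMod.natCast_eq_zero_iff_even).2 hn] at this
  exact this

theorem involute_cliffordVolume {n : ℕ} (hn : Odd n) (v : Fin n → V) :
    CliffordAlgebra.involute (cliffordVolume Q n v) = -cliffordVolume Q n v := by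
  have := cliffordVolume_mem_evenOdd (Q := Q) v
  rw [(ZMod.natCast_eq_one_iff_odd).2 hn] at this
  exact CliffordAlgebra.involute_eq_of_mem_odd this

theorem commute_cliffordVolume_of_odd {n : ℕ} (hn : Odd n) (b : Basis (Fin n) ℝ V)
    (hQ : (QuadraticMap.associated (R := ℝ) Q).SeparatingLeft) (a : CliffordAlgebra Q) :
    Commute a (cliffordVolume Q n b) := by
  induction a using CliffordAlgebra.induction with
  | algebraMap r => exact Algebra.commute_algebraMap_left r _
  | ι v =>
    have := ι_mul_cliffordVolume b hQ v
    rwa [(Nat.Odd.sub_odd hn odd_one).neg_one_pow, one_mul] at this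
  | mul a b ha hb => exact ha.mul_left hb
  | add a b ha hb => exact ha.add_left hb

theorem ι_mul_cliffordVolume_of_even {n : ℕ} (hn : Even n) (h0 : 1 ≤ n) (b : Basis (Fin n) ℝ V)
    (hQ : (QuadraticMap.associated (R := ℝ) Q).SeparatingLeft) (v : V) :
    CliffordAlgebra.ι Q v * cliffordVolume Q n b =
      -(cliffordVolume Q n b * CliffordAlgebra.ι Q v) := by
  rw [ι_mul_cliffordVolume b hQ v, (Nat.Even.sub_odd h0 hn odd_one).neg_one_pow, neg_one_mul]

theorem commute_cliffordVolume_of_mem_even {n : ℕ} (hn : Even n) (h0 : 1 ≤ n)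
    (b : Basis (Fin n) ℝ V) (hQ : (QuadraticMap.associated (R := ℝ) Q).SeparatingLeft)
    {a : CliffordAlgebra Q} (ha : a ∈ CliffordAlgebra.even Q) :
    Commute a (cliffordVolume Q n b) := by
  change a ∈ CliffordAlgebra.evenOdd Q 0 at ha
  induction a, ha using CliffordAlgebra.even_induction with
  | algebraMap r => exact Algebra.commute_algebraMap_left r _
  | add x y _ _ hx hy => exact hx.add_left hy
  | ι_mul_ι_mul v w x _ hx =>
    refine Commute.mul_left ?_ hx
    have hv := ι_mul_cliffordVolume_of_even hn h0 b hQ v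
    have hw := ι_mul_cliffordVolume_of_even hn h0 b hQ w
    rw [commute_iff_eq, mul_assoc, hw, mul_neg, ← mul_assoc, hv, neg_mul, neg_neg, mul_assoc]

end Volume

/-! ### Invariant subspaces of spinor representations -/

section InvariantSubspaces

/-- Eigenspaces for opposite eigenvalues of an operator with scalar square are complementary. -/
theorem isCompl_eigenspace_of_sq {S : Type*} [AddCommGroup S] [Module ℂ S] (K : Module.End ℂ S)
    {c : ℂ} (hc : c ≠ 0) (hK : K * K = (c ^ 2) • 1) :
    IsCompl (Module.End.eigenspace K c) (Module.End.eigenspace K (-c)) := by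
  have hKK : ∀ s, K (K s) = (c ^ 2) • s := fun s ↦ by simpa using LinearMap.congr_fun hK s
  constructor
  · rw [Submodule.disjoint_def]
    intro s h1 h2
    rw [Module.End.mem_eigenspace_iff] at h1 h2
    rw [h1, ← sub_eq_zero, ← sub_smul, sub_neg_eq_add, smul_eq_zero] at h2
    exact h2.resolve_left (by simpa [← two_mul] using hc)
  · rw [codisjoint_iff, eq_top_iff]
    intro s _
    have h1 : s + c⁻¹ • K s ∈ Module.End.eigenspace K c := by
      rw [Module.End.mem_eigenspace_iff, map_add, map_smul, hKK, smul_add, smul_smul, smul_smul,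
        mul_inv_cancel₀ hc, one_smul, add_comm]
      congr 2
      field_simp
    have h2 : s - c⁻¹ • K s ∈ Module.End.eigenspace K (-c) := by
      rw [Module.End.mem_eigenspace_iff, map_sub, map_smul, hKK, smul_sub, smul_smul, smul_smul,
        neg_mul, mul_inv_cancel₀ hc, neg_smul, neg_smul, one_smul, sub_neg_eq_add, add_comm,
        sub_eq_add_neg]
      congr 2
      field_simp
    rw [Submodule.mem_sup]
    refine ⟨_, Submodule.smul_mem _ (2⁻¹ : ℂ) h1, _, Submodule.smul_mem _ (2⁻¹ : ℂ) h2, ?_⟩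
    module

/-- An injective operator anticommuting with `K` embeds each eigenspace into the opposite one, so
the two complementary eigenspaces have equal dimension. -/
theorem two_mul_finrank_eigenspace {S : Type*} [AddCommGroup S] [Module ℂ S]
    [FiniteDimensional ℂ S] (K J : Module.End ℂ S) {c : ℂ} (hc : c ≠ 0)
    (hK : K * K = (c ^ 2) • 1) (hJ : Function.Injective J) (hJK : ∀ s, J (K s) = -K (J s)) :
    2 * finrank ℂ (Module.End.eigenspace K c) = finrank ℂ S := by
  have hle : ∀ d : ℂ, finrank ℂ (Module.End.eigenspace K d) ≤
      finrank ℂ (Module.End.eigenspace K (-d)) := by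
    intro d
    have h : (Module.End.eigenspace K d).map J ≤ Module.End.eigenspace K (-d) := by
      rintro _ ⟨s, hs, rfl⟩
      have hs : K s = d • s := Module.End.mem_eigenspace_iff.1 hs
      rw [Module.End.mem_eigenspace_iff, neg_smul, ← map_smul, ← hs, hJK, neg_neg]
    calc _ = finrank ℂ ((Module.End.eigenspace K d).map J) :=
          (LinearEquiv.finrank_eq (Submodule.equivMapOfInjective J hJ _))
      _ ≤ _ := Submodule.finrank_mono h
  have h1 := hle c
  have h2 := hle (-c)
  rw [neg_neg] at h2
  have := Submodule.finrank_add_eq_of_isCompl (isCompl_eigenspace_of_sq K hc hK)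
  omega

/-- If the only `K`-stable members of a family of subspaces inside the eigenspaces of `K` are the
trivial ones, then a nontrivial member of the family is contained in an eigenspace. -/
theorem scalar_of_eigenspace_irreducible {S : Type*} [AddCommGroup S] [Module ℂ S]
    (K : Module.End ℂ S) {c : ℂ} (hc : c ≠ 0) (hK : K * K = (c ^ 2) • 1)
    (Inv : Submodule ℂ S → Prop)
    (hInv : ∀ W d, Inv W → Inv (W ⊓ Module.End.eigenspace K d))
    (hIrr : ∀ W d, d ^ 2 = c ^ 2 → Inv W → W ≤ Module.End.eigenspace K d →
      W = ⊥ ∨ W = Module.End.eigenspace K d)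
    (W : Submodule ℂ S) (hW : Inv W) (hWK : ∀ s ∈ W, K s ∈ W) (ht : W ≠ ⊤) :
    ∃ d : ℂ, d ^ 2 = c ^ 2 ∧ ∀ s ∈ W, K s = d • s := by
  have hKK : ∀ s, K (K s) = (c ^ 2) • s := fun s ↦ by simpa using LinearMap.congr_fun hK s
  -- Since `K² = d²`, the vector `K s + d • s` is a `d`-eigenvector lying in `W`. If `W` meets that
  -- eigenspace trivially, `K` is `-d` on `W`.
  have step : ∀ d : ℂ, d ^ 2 = c ^ 2 → W ⊓ Module.End.eigenspace K d = ⊥ →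
      ∀ s ∈ W, K s = (-d) • s := by
    intro d hd h s hs
    have : K s + d • s ∈ W ⊓ Module.End.eigenspace K d := by
      refine ⟨W.add_mem (hWK s hs) (W.smul_mem _ hs), ?_⟩
      change _ ∈ Module.End.eigenspace K d
      rw [Module.End.mem_eigenspace_iff, map_add, map_smul, hKK, ← hd]
      module
    rw [h, Submodule.mem_bot] at this
    rw [neg_smul, eq_neg_of_add_eq_zero_left this]
  rcases hIrr _ c rfl (hInv W c hW) inf_le_right with h1 | h1
  · exact ⟨-c, neg_sq c, step c rfl h1⟩
  rcases hIrr _ (-c) (neg_sq c) (hInv W (-c) hW) inf_le_right with h2 | h2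
  · exact ⟨c, rfl, by simpa using step (-c) (neg_sq c) h2⟩
  -- In the remaining case `W` contains both eigenspaces, hence everything.
  · refine absurd (top_unique ?_) ht
    rw [← (isCompl_eigenspace_of_sq K hc hK).sup_eq_top]
    exact sup_le (inf_eq_right.1 h1) (inf_eq_right.1 h2)

theorem inf_eigenspace_invariant {S : Type*} [AddCommGroup S] [Module ℂ S] {K L : Module.End ℂ S}
    (h : Commute L K) {W : Submodule ℂ S} (hW : ∀ s ∈ W, L s ∈ W) (d : ℂ) :
    ∀ s ∈ W ⊓ Module.End.eigenspace K d, L s ∈ W ⊓ Module.End.eigenspace K d := by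
  rintro s ⟨h1, h2⟩
  refine ⟨hW s h1, ?_⟩
  have h2 : K s = d • s := Module.End.mem_eigenspace_iff.1 h2
  change _ ∈ Module.End.eigenspace K d
  rw [Module.End.mem_eigenspace_iff, ← map_smul, ← h2]
  exact (LinearMap.congr_fun h.eq s).symm

variable {V : Type*} [AddCommGroup V] [Module ℝ V] {Q : QuadraticForm ℝ V}
  {S : Type*} [AddCommGroup S] [Module ℂ S]

theorem cliffordRep_invariant_of_ι (ρ : CliffordAlgebra Q →ₐ[ℝ] Module.End ℂ S)
    {W : Submodule ℂ S} (h : ∀ v, ∀ s ∈ W, ρ (CliffordAlgebra.ι Q v) s ∈ W)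
    (a : CliffordAlgebra Q) : ∀ s ∈ W, ρ a s ∈ W := by
  induction a using CliffordAlgebra.induction with
  | algebraMap r =>
    intro s hs
    rw [AlgHom.commutes]
    simpa using W.smul_mem (r : ℂ) hs
  | ι v => exact h v
  | mul a b ha hb => exact fun s hs ↦ by simpa using ha _ (hb s hs)
  | add a b ha hb => exact fun s hs ↦ by simpa using W.add_mem (ha s hs) (hb s hs)

/-- A nontrivial subspace of an irreducible representation that is invariant under the even
subalgebra has half the dimension. -/
theorem two_mul_finrank_of_even_invariant [FiniteDimensional ℂ S]
    {ρ : CliffordAlgebra Q →ₐ[ℝ] Module.End ℂ S} (hρ : IsIrreducibleRep ρ) {v : V} (hv : Q v ≠ 0)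
    {W : Submodule ℂ S} (hW : ∀ a ∈ CliffordAlgebra.even Q, ∀ s ∈ W, ρ a s ∈ W)
    (hb : W ≠ ⊥) (ht : W ≠ ⊤) : 2 * finrank ℂ W = finrank ℂ S := by
  set J := ρ (CliffordAlgebra.ι Q v) with hJdef
  have hJJ : ∀ s, J (J s) = Q v • s := fun s ↦ by
    have := LinearMap.congr_fun (congrArg ρ (CliffordAlgebra.ι_sq_scalar Q v)) s
    rwa [map_mul, AlgHom.commutes] at this
  have hJinj : Function.Injective J := fun s t h ↦ by
    have := congrArg J h
    rw [hJJ, hJJ] at this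
    exact smul_right_injective S hv this
  have h1 : ∀ u, ∀ s ∈ W, ρ (CliffordAlgebra.ι Q u) (J s) ∈ W := fun u s hs ↦ by
    have := hW (CliffordAlgebra.ι Q u * CliffordAlgebra.ι Q v)
      (CliffordAlgebra.ι_mul_ι_mem_evenOdd_zero Q u v) s hs
    simpa using this
  have h2 : ∀ u, ∀ s ∈ W, ρ (CliffordAlgebra.ι Q u) s ∈ W.map J := fun u s hs ↦ by
    have := hW (CliffordAlgebra.ι Q v * CliffordAlgebra.ι Q u)
      (CliffordAlgebra.ι_mul_ι_mem_evenOdd_zero Q v u) s hs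
    rw [map_mul] at this
    refine ⟨(((Q v)⁻¹ : ℝ) : ℂ) • (J (ρ (CliffordAlgebra.ι Q u) s)),
      W.smul_mem _ this, ?_⟩
    rw [map_smul, hJJ, Complex.coe_smul, smul_smul, inv_mul_cancel₀ hv, one_smul]
  -- Vectors exchange `W` and `J W`, so their sum and intersection are invariant under the whole
  -- algebra. Irreducibility then makes `J W` a complement of `W`.
  have hsup := hρ.2 (W ⊔ W.map J) (cliffordRep_invariant_of_ι ρ fun u s hs ↦ by
    obtain ⟨s1, hs1, _, ⟨s2, hs2, rfl⟩, rfl⟩ := Submodule.mem_sup.1 hs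
    rw [map_add, add_comm]
    exact Submodule.add_mem_sup (h1 u s2 hs2) (h2 u s1 hs1))
  have hinf := hρ.2 (W ⊓ W.map J) (cliffordRep_invariant_of_ι ρ (by
    rintro u _ ⟨hs1, ⟨s2, hs2, rfl⟩⟩
    exact ⟨h1 u s2 hs2, h2 u _ hs1⟩))
  have hsup' : W ⊔ W.map J = ⊤ := hsup.resolve_left fun h ↦ hb (le_bot_iff.1 (h ▸ le_sup_left))
  have hinf' : W ⊓ W.map J = ⊥ := hinf.resolve_right fun h ↦ ht (top_le_iff.1 (h ▸ inf_le_left))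
  have h3 := Submodule.finrank_sup_add_finrank_inf_eq W (W.map J)
  rw [hsup', hinf', finrank_top, finrank_bot,
    ← LinearEquiv.finrank_eq (Submodule.equivMapOfInjective J hJinj W)] at h3
  omega

/-- Eigenspaces and invariant subspaces of the volume element in a Dirac representation. -/
theorem IsDiracRep.cliffordVolume_eigenspaces {n : ℕ} (hn : Even n) (h0 : 1 ≤ n)
    (b : Basis (Fin n) ℝ V) (hQ : (QuadraticMap.associated (R := ℝ) Q).SeparatingLeft)
    {ρ : CliffordAlgebra Q →ₐ[ℝ] Module.End ℂ S} (hρ : IsDiracRep ρ)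
    {c : ℂ} (hc : c ≠ 0)
    (hK : ρ (cliffordVolume Q n b) * ρ (cliffordVolume Q n b) = (c ^ 2) • 1) :
    2 * finrank ℂ (Module.End.eigenspace (ρ (cliffordVolume Q n b)) c) = 2 ^ ((n + 1) / 2) ∧
    ∀ W : Submodule ℂ S, (∀ a ∈ CliffordAlgebra.even Q, ∀ s ∈ W, ρ a s ∈ W) → W ≠ ⊥ → W ≠ ⊤ →
      ∃ d : ℂ, d ^ 2 = c ^ 2 ∧ ∀ s ∈ W, ρ (cliffordVolume Q n b) s = d • s := by
  obtain ⟨-, hirr, hdim⟩ := hρ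
  have hV : finrank ℝ V = n := by simpa using finrank_eq_card_basis b
  -- `finrank` is 0 in infinite dimension, so a positive value forces finite dimension.
  have hpos : 0 < finrank ℂ S := by rw [hdim]; positivity
  have : FiniteDimensional ℂ S := Module.finite_of_finrank_pos hpos
  obtain ⟨e, -, he⟩ := exists_orthogonal_basis_of_separatingLeft b hQ
  have hv := he ⟨0, h0⟩
  set v := e ⟨0, h0⟩
  set K := ρ (cliffordVolume Q n b) with hKdef
  have hJinj : Function.Injective (ρ (CliffordAlgebra.ι Q v)) := fun s t h ↦ by
    have h' := congrArg (ρ (CliffordAlgebra.ι Q v)) h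
    simp only [← Module.End.mul_apply, ← map_mul, CliffordAlgebra.ι_sq_scalar,
      AlgHom.commutes] at h'
    exact smul_right_injective S hv (by simpa using h')
  have hdimK : ∀ d : ℂ, d ^ 2 = c ^ 2 →
      2 * finrank ℂ (Module.End.eigenspace K d) = finrank ℂ S := fun d hd ↦
    two_mul_finrank_eigenspace K (ρ (CliffordAlgebra.ι Q v))
      (by rintro rfl; exact hc (by simpa using hd.symm)) (by rw [hd, hK]) hJinj fun s ↦ by
        have := LinearMap.congr_fun
          (congrArg ρ (ι_mul_cliffordVolume_of_even hn h0 b hQ v)) s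
        simpa using this
  refine ⟨?_, fun W hW hb ht ↦ ?_⟩
  · rw [hdimK c rfl, hdim, hV]
    congr 1
    obtain ⟨k, rfl⟩ := hn
    omega
  · refine scalar_of_eigenspace_irreducible K hc hK
      (fun W ↦ ∀ a ∈ CliffordAlgebra.even Q, ∀ s ∈ W, ρ a s ∈ W)
      (fun W d hW a ha ↦ inf_eigenspace_invariant
        ((commute_cliffordVolume_of_mem_even hn h0 b hQ ha).map ρ) (hW a ha) d)
      (fun W d hd hW hle ↦ ?_) W hW (hW _ (cliffordVolume_mem_even hn b)) ht
    by_cases hWb : W = ⊥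
    · exact Or.inl hWb
    · have h1 := hdimK d hd
      have hWt : W ≠ ⊤ := by
        rintro rfl
        rw [top_le_iff] at hle
        rw [hle, finrank_top] at h1
        omega
      -- `W` and the eigenspace containing it both have half the total dimension, so they coincide.
      have h2 := two_mul_finrank_of_even_invariant hirr hv hW hWb hWt
      exact Or.inr (Submodule.eq_of_le_of_finrank_eq hle (by omega))

/-- Eigenspaces and invariant subspaces of the volume element in a Cartan representation. -/
theorem IsCartanRep.cliffordVolume_eigenspaces {n : ℕ} (hn : Odd n)
    (b : Basis (Fin n) ℝ V) (hQ : (QuadraticMap.associated (R := ℝ) Q).SeparatingLeft)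
    {ρ : CliffordAlgebra Q →ₐ[ℝ] Module.End ℂ S} (hρ : IsCartanRep ρ)
    {c : ℂ} (hc : c ≠ 0)
    (hK : ρ (cliffordVolume Q n b) * ρ (cliffordVolume Q n b) = (c ^ 2) • 1) :
    2 * finrank ℂ (Module.End.eigenspace (ρ (cliffordVolume Q n b)) c) = 2 ^ ((n + 1) / 2) ∧
    ∀ W : Submodule ℂ S, (∀ a, ∀ s ∈ W, ρ a s ∈ W) → W ≠ ⊥ → W ≠ ⊤ →
      ∃ d : ℂ, d ^ 2 = c ^ 2 ∧ ∀ s ∈ W, ρ (cliffordVolume Q n b) s = d • s := by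
  have hV : finrank ℝ V = n := by simpa using finrank_eq_card_basis b
  obtain ⟨σ, ⟨-, ⟨hnt, hirr⟩, -⟩, φ, hφ⟩ := hρ
  set η := cliffordVolume Q n b with hη
  set K := ρ η with hKdef
  have : FiniteDimensional ℂ S := φ.symm.finiteDimensional
  -- the volume element acts by a scalar in the Pauli representation
  obtain ⟨c₀, hc₀⟩ := Module.End.exists_eigenvalue (σ η)
  have htop : Module.End.eigenspace (σ η) c₀ = ⊤ := by
    refine (hirr _ fun a s hs ↦ ?_).resolve_left hc₀
    have h := inf_eigenspace_invariant (W := ⊤)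
      ((commute_cliffordVolume_of_odd hn b hQ (a : CliffordAlgebra Q)).map σ)
      (fun _ _ ↦ trivial) c₀ s ⟨trivial, hs⟩
    exact h.2
  have hση : ∀ s, σ η s = c₀ • s := fun s ↦
    Module.End.mem_eigenspace_iff.1 (htop ▸ Submodule.mem_top)
  have hKφ : ∀ s, φ (K s) = (c₀ • (φ s).1, -(c₀ • (φ s).2)) := fun s ↦ by
    rw [hφ η s, ← Prod.mk.eta (p := φ s), cartanRep_apply, involute_cliffordVolume hn, map_neg]
    simp [← hη, hση]
  have hρe : ∀ a ∈ CliffordAlgebra.even Q, ∀ s, φ (ρ a s) = (σ a (φ s).1, σ a (φ s).2) :=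
    fun a ha s ↦ by
    rw [hφ a s, ← Prod.mk.eta (p := φ s), cartanRep_apply,
      CliffordAlgebra.involute_eq_of_mem_even ha]
  have hKK : ∀ s, K (K s) = (c ^ 2) • s := fun s ↦ by simpa using LinearMap.congr_fun hK s
  obtain ⟨s₀, hs₀⟩ := exists_ne (0 : Fin (2 ^ (finrank ℝ V / 2)) → ℂ)
  have hc₀2 : c₀ ^ 2 = c ^ 2 := by
    have h := congrArg φ (hKK (φ.symm (s₀, 0)))
    rw [hKφ, hKφ, map_smul] at h
    have := congrArg Prod.fst h
    simp only [LinearEquiv.apply_symm_apply, Prod.smul_mk, smul_smul] at this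
    rw [← sq] at this
    exact smul_left_injective ℂ hs₀ this
  have hc₀0 : c₀ ≠ 0 := by
    rintro rfl
    exact hc (by simpa using hc₀2.symm)
  -- Exchanging the two summands anticommutes with `K`, which is `c₀` on the first and `-c₀` on the
  -- second.
  let J : Module.End ℂ S := φ.symm.toLinearMap ∘ₗ
    (LinearEquiv.prodComm ℂ _ _).toLinearMap ∘ₗ φ.toLinearMap
  have hJφ : ∀ s, φ (J s) = ((φ s).2, (φ s).1) := fun s ↦ by simp [J, Prod.swap]
  refine ⟨?_, fun W hW hb ht ↦ ?_⟩
  · rw [two_mul_finrank_eigenspace K J hc hK]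
    · rw [φ.finrank_eq, finrank_prod]
      simp only [finrank_fintype_fun_eq_card, Fintype.card_fin, hV]
      obtain ⟨k, rfl⟩ := hn
      rw [show (2 * k + 1) / 2 = k by omega, show (2 * k + 1 + 1) / 2 = k + 1 by omega]
      ring
    · intro s t h
      have := congrArg φ h
      rw [hJφ, hJφ, Prod.mk.injEq] at this
      exact φ.injective (Prod.ext this.2 this.1)
    · intro s
      apply φ.injective
      rw [hJφ, map_neg, hKφ, hKφ, hJφ]
      simp
  · refine scalar_of_eigenspace_irreducible K hc hK
      (fun W ↦ ∀ a, ∀ s ∈ W, ρ a s ∈ W)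
      (fun W d hW a ↦ inf_eigenspace_invariant
        ((commute_cliffordVolume_of_odd hn b hQ a).map ρ) (hW a) d)
      (fun W d hd hW hle ↦ ?_) W hW (hW _) ht
    -- A projection to one summand intertwines the even actions, so it sends `W` to zero or to the
    -- whole Pauli space. Where it is injective on the eigenspace, this decides `W`. The eigenspace
    -- is the first or the second summand according to the sign in `d = ±c₀`.
    have main : ∀ p : ((Fin (2 ^ (finrank ℝ V / 2)) → ℂ) ×
          (Fin (2 ^ (finrank ℝ V / 2)) → ℂ)) →ₗ[ℂ] (Fin (2 ^ (finrank ℝ V / 2)) → ℂ),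
        (∀ a ∈ CliffordAlgebra.even Q, ∀ s, p (φ (ρ a s)) = σ a (p (φ s))) →
        (∀ s ∈ Module.End.eigenspace K d, p (φ s) = 0 → s = 0) →
        W = ⊥ ∨ W = Module.End.eigenspace K d := by
      intro p hp hinj
      rcases hirr (W.map (p ∘ₗ φ.toLinearMap)) (by
        rintro a _ ⟨s, hs, rfl⟩
        exact ⟨ρ a s, hW a s hs, hp a a.2 s⟩) with h | h
      · left
        rw [eq_bot_iff]
        intro s hs
        have : p (φ s) ∈ W.map (p ∘ₗ φ.toLinearMap) := ⟨s, hs, rfl⟩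
        rw [h, Submodule.mem_bot] at this
        exact hinj s (hle hs) this
      · right
        refine le_antisymm hle fun t ht ↦ ?_
        have : p (φ t) ∈ W.map (p ∘ₗ φ.toLinearMap) := h ▸ Submodule.mem_top
        obtain ⟨s, hs, hst⟩ := this
        have := hinj (s - t) (Submodule.sub_mem _ (hle hs) ht)
          (by rw [map_sub, map_sub, sub_eq_zero]; exact hst)
        rwa [← sub_eq_zero.1 this]
    have hx : ∀ x : Fin (2 ^ (finrank ℝ V / 2)) → ℂ, c₀ • x = -(c₀ • x) → x = 0 := fun x h ↦ by
      have := self_eq_neg.1 h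
      exact (smul_eq_zero.1 this).resolve_left hc₀0
    have hd' : ∀ s ∈ Module.End.eigenspace K d,
        c₀ • (φ s).1 = d • (φ s).1 ∧ -(c₀ • (φ s).2) = d • (φ s).2 := fun s hs ↦ by
      have := congrArg φ (Module.End.mem_eigenspace_iff.1 hs)
      rw [hKφ, map_smul] at this
      exact ⟨congrArg Prod.fst this, congrArg Prod.snd this⟩
    rcases sq_eq_sq_iff_eq_or_eq_neg.1 (hd.trans hc₀2.symm) with rfl | rfl
    · refine main (LinearMap.fst ℂ _ _) (fun a ha s ↦ by simp [hρe a ha s]) fun s hs h ↦ ?_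
      have h2 := hx _ (hd' s hs).2.symm
      exact φ.injective (by rw [map_zero]; exact Prod.ext h h2)
    · refine main (LinearMap.snd ℂ _ _) (fun a ha s ↦ by simp [hρe a ha s]) fun s hs h ↦ ?_
      have h2 := hx _ (by simpa using (hd' s hs).1)
      exact φ.injective (by rw [map_zero]; exact Prod.ext h2 h)

end InvariantSubspaces

/-! ### Coordinate frames and volume elements on a manifold -/

section ChartFrames

variable {m : ℕ} {M : Type*} [TopologicalSpace M] [ChartedSpace (EuclideanSpace ℝ (Fin m)) M]

/-- The coordinate isomorphism from the model space to the tangent space at `x` given by a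
chart. -/
def chartFrame (e : OpenPartialHomeomorph M (EuclideanSpace ℝ (Fin m))) (x : M) :
    EuclideanSpace ℝ (Fin m) →L[ℝ] TangentSpace (𝓡 m) x :=
  mfderiv (𝓡 m) (𝓡 m) e.symm (e x)

variable {e e' : OpenPartialHomeomorph M (EuclideanSpace ℝ (Fin m))}

theorem hasMFDerivAt_chart_symm (he : e ∈ IsManifold.maximalAtlas (𝓡 m) ∞ M) {x : M}
    (hx : x ∈ e.source) : HasMFDerivAt (𝓡 m) (𝓡 m) e.symm (e x) (chartFrame e x) :=
  ((contMDiffOn_symm_of_mem_maximalAtlas he).contMDiffAt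
    (e.open_target.mem_nhds (e.map_source hx))).mdifferentiableAt (by simp) |>.hasMFDerivAt

theorem hasFDerivAt_transition (he : e ∈ IsManifold.maximalAtlas (𝓡 m) ∞ M)
    (he' : e' ∈ IsManifold.maximalAtlas (𝓡 m) ∞ M) {x : M} (hx : x ∈ e.source)
    (hx' : x ∈ e'.source) :
    HasFDerivAt (e.symm.trans e') (fderiv ℝ (e.symm.trans e') (e x)) (e x) := by
  have h1 := (contMDiffOn_symm_of_mem_maximalAtlas he).contMDiffAt
    (e.open_target.mem_nhds (e.map_source hx))
  have h2 : ContMDiffAt (𝓡 m) (𝓡 m) ∞ e' (e.symm (e x)) := by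
    rw [e.left_inv hx]
    exact (contMDiffOn_of_mem_maximalAtlas he').contMDiffAt (e'.open_source.mem_nhds hx')
  exact ((h2.comp (e x) h1).contDiffAt.differentiableAt (by simp)).hasFDerivAt

/-- The chain rule for `e.symm = e'.symm ∘ (e.symm.trans e')`, valid near `e x`. -/
theorem chartFrame_eq_comp (he : e ∈ IsManifold.maximalAtlas (𝓡 m) ∞ M)
    (he' : e' ∈ IsManifold.maximalAtlas (𝓡 m) ∞ M) {x : M} (hx : x ∈ e.source)
    (hx' : x ∈ e'.source) :
    chartFrame e x = (chartFrame e' x).comp (fderiv ℝ (e.symm.trans e') (e x)) := by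
  have h0 : (e.symm.trans e') (e x) = e' x := by simp [e.left_inv hx]
  have h1 : ∀ y, y = e' x → HasMFDerivAt (𝓡 m) (𝓡 m) e'.symm y (chartFrame e' x) := by
    rintro _ rfl
    exact hasMFDerivAt_chart_symm he' hx'
  have h2 := (h1 _ h0).comp (e x)
    (hasMFDerivAt_iff_hasFDerivAt.2 (hasFDerivAt_transition he he' hx hx'))
  have h3 : e.symm =ᶠ[nhds (e x)] (e'.symm ∘ (e.symm.trans e')) := by
    have : (e.symm.trans e').source ∈ nhds (e x) :=
      (e.symm.trans e').open_source.mem_nhds (by simp [hx, hx', e.left_inv hx])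
    filter_upwards [this] with y hy
    simp only [OpenPartialHomeomorph.trans_source, OpenPartialHomeomorph.symm_source,
      mem_inter_iff, mem_preimage] at hy
    simp [e'.left_inv hy.2]
  exact hasMFDerivAt_unique (hasMFDerivAt_chart_symm he hx) (h2.congr_of_eventuallyEq h3)

theorem injective_chartFrame (he : e ∈ IsManifold.maximalAtlas (𝓡 m) ∞ M) {x : M}
    (hx : x ∈ e.source) : Function.Injective (chartFrame e x) := by
  have h1 : ∀ y, y = x → MDifferentiableAt (𝓡 m) (𝓡 m) e y := by
    rintro _ rfl
    exact ((contMDiffOn_of_mem_maximalAtlas he).contMDiffAt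
      (e.open_source.mem_nhds hx)).mdifferentiableAt (by simp)
  have h2 := (h1 _ (e.left_inv hx)).hasMFDerivAt.comp (e x) (hasMFDerivAt_chart_symm he hx)
  have h3 : id =ᶠ[nhds (e x)] (e ∘ e.symm) := by
    filter_upwards [e.open_target.mem_nhds (e.map_source hx)] with y hy
    simp [e.right_inv hy]
  have h4 := hasMFDerivAt_unique (hasMFDerivAt_id (I := 𝓡 m) (e x))
    (h2.congr_of_eventuallyEq h3)
  intro v w hvw
  have h5 := fun u ↦ congrArg (fun f ↦ f u) h4
  exact (h5 v).trans ((congrArg _ hvw).trans (h5 w).symm)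

theorem exists_basis_chartFrame (he : e ∈ IsManifold.maximalAtlas (𝓡 m) ∞ M) {x : M}
    (hx : x ∈ e.source) : ∃ b : Basis (Fin m) ℝ (TangentSpace (𝓡 m) x),
      ∀ i, b i = chartFrame e x ((EuclideanSpace.basisFun (Fin m) ℝ).toBasis i) := by
  have : FiniteDimensional ℝ (TangentSpace (𝓡 m) x) :=
    inferInstanceAs (FiniteDimensional ℝ (EuclideanSpace ℝ (Fin m)))
  let f : EuclideanSpace ℝ (Fin m) ≃ₗ[ℝ] TangentSpace (𝓡 m) x :=
    LinearMap.linearEquivOfInjective (chartFrame e x : _ →ₗ[ℝ] _)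
      (injective_chartFrame he hx) rfl
  exact ⟨(EuclideanSpace.basisFun (Fin m) ℝ).toBasis.map f, fun i ↦ rfl⟩

variable [IsManifold (𝓡 m) ∞ M]

/-- The field is the tangent map of `e.symm` applied to a constant field on the model space. -/
theorem contMDiffOn_chartFrame (he : e ∈ IsManifold.maximalAtlas (𝓡 m) ∞ M)
    (v : EuclideanSpace ℝ (Fin m)) :
    IsSmoothVectorFieldOn (fun x : M ↦ chartFrame e x v) e.source := by
  have : IsManifold (𝓡 m) 1 M := IsManifold.of_le (n := ∞) (by simp)
  have h1 := (contMDiffOn_symm_of_mem_maximalAtlas he).contMDiffOn_tangentMapWithin (m := ∞)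
    (by simp) e.open_target.uniqueMDiffOn
  have h2 : ContMDiffOn (𝓡 m) (𝓡 m).tangent ∞
      (fun y ↦ (⟨y, v⟩ : TangentBundle (𝓡 m) (EuclideanSpace ℝ (Fin m)))) univ :=
    contMDiffOn_vectorSpace_iff_contDiffOn.2 contDiffOn_const
  have h3 := h1.comp (h2.comp (contMDiffOn_of_mem_maximalAtlas he) fun _ _ ↦ mem_univ _)
    fun x hx ↦ e.map_source hx
  refine h3.congr fun x hx ↦ ?_
  -- The base point `e.symm (e x)` is only propositionally `x`; the tangent spaces are all the model
  -- space, so the vector can be transported unchanged.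
  have h4 : ∀ (y : M) (w : EuclideanSpace ℝ (Fin m)), y = x →
      (⟨x, w⟩ : TangentBundle (𝓡 m) M) = ⟨y, w⟩ := by
    rintro _ _ rfl
    rfl
  have h5 : mfderivWithin (𝓡 m) (𝓡 m) e.symm e.target (e x) = mfderiv (𝓡 m) (𝓡 m) e.symm (e x) :=
    mfderivWithin_of_isOpen e.open_target (e.map_source hx)
  refine (h4 (e.symm (e x)) (chartFrame e x v) (e.left_inv hx)).trans ?_
  simp only [Function.comp_apply, tangentMapWithin]
  rw [h5]
  rfl

/-- The volume element of the Clifford algebra at `x` given by the coordinate frame of a chart. -/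
def chartVolume (g : PseudoRiemannianMetric m M)
    (e : OpenPartialHomeomorph M (EuclideanSpace ℝ (Fin m))) (x : M) : g.Cl x :=
  cliffordVolume (g.quadraticForm x) m
    fun i ↦ chartFrame e x ((EuclideanSpace.basisFun (Fin m) ℝ).toBasis i)

theorem chartVolume_eq_det_smul (g : PseudoRiemannianMetric m M)
    (he : e ∈ IsManifold.maximalAtlas (𝓡 m) ∞ M)
    (he' : e' ∈ IsManifold.maximalAtlas (𝓡 m) ∞ M) {x : M} (hx : x ∈ e.source)
    (hx' : x ∈ e'.source) :
    chartVolume g e x = (fderiv ℝ (e.symm.trans e') (e x)).det • chartVolume g e' x := by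
  set b := (EuclideanSpace.basisFun (Fin m) ℝ).toBasis with hb
  have h := AlternatingMap.apply_eq_det_smul b
    ((cliffordVolume (g.quadraticForm x) m).compLinearMap (chartFrame e' x : _ →ₗ[ℝ] _))
    ((fderiv ℝ (e.symm.trans e') (e x) : _ →ₗ[ℝ] _) ∘ b)
  rw [Basis.det_comp, Basis.det_self, mul_one] at h
  rw [chartVolume, chartFrame_eq_comp he he' hx hx']
  exact h

theorem PseudoRiemannianMetric.separatingLeft (g : PseudoRiemannianMetric m M) (x : M) :
    (QuadraticMap.associated (R := ℝ) (g.quadraticForm x)).SeparatingLeft := by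
  intro v hv
  refine g.nondegenerate x v fun w ↦ ?_
  have h := hv w
  rw [QuadraticMap.associated_apply] at h
  simp only [g.quadraticForm_apply, map_add, add_apply, g.symm x w v] at h
  have h' : (2 : ℝ)⁻¹ * (2 * g.inner x v w) = 0 := by
    rw [← h]
    simp
    ring
  linarith

/-- The eigenspaces and the invariant subspaces of the volume element in a spinor bundle. -/
theorem CliffordModuleStructure.IsSpinorBundle.chartVolume_eigenspaces (hm : 1 ≤ m)
    {g : PseudoRiemannianMetric m M}
    {F : Type*} [NormedAddCommGroup F] [NormedSpace ℂ F]
    {E : M → Type*} [∀ x, AddCommGroup (E x)] [∀ x, Module ℂ (E x)]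
    [∀ x, TopologicalSpace (E x)] [TopologicalSpace (TotalSpace F E)] [FiberBundle F E]
    {τ : CliffordModuleStructure F E g} (hτ : τ.IsSpinorBundle)
    (he : e ∈ IsManifold.maximalAtlas (𝓡 m) ∞ M) {x : M} (hx : x ∈ e.source) {c : ℂ} (hc : c ≠ 0)
    (hK : τ.hom x (chartVolume g e x) * τ.hom x (chartVolume g e x) = (c ^ 2) • 1) :
    2 * finrank ℂ (Module.End.eigenspace (τ.hom x (chartVolume g e x)) c) = 2 ^ ((m + 1) / 2) ∧
    ∀ W : Submodule ℂ (E x), (∀ a, ∀ s ∈ W, τ.homD x a s ∈ W) → W ≠ ⊥ → W ≠ ⊤ →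
      ∃ d : ℂ, d ^ 2 = c ^ 2 ∧ ∀ s ∈ W, τ.hom x (chartVolume g e x) s = d • s := by
  obtain ⟨b, hb⟩ := exists_basis_chartFrame he hx
  have hvol : chartVolume g e x = cliffordVolume (g.quadraticForm x) m b := by
    rw [chartVolume]
    congr 1
    exact (funext hb).symm
  rw [hvol] at hK ⊢
  rcases Nat.even_or_odd m with h | h
  · obtain ⟨h1, h2⟩ := ((hτ x).1 h).cliffordVolume_eigenspaces h hm b (g.separatingLeft x) hc hK
    refine ⟨h1, fun W hW ↦ h2 W fun a ha ↦ hW ⟨a, ?_⟩⟩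
    rwa [PseudoRiemannianMetric.ClD, if_neg (Nat.not_odd_iff_even.2 h)]
  · obtain ⟨h1, h2⟩ := ((hτ x).2 h).cliffordVolume_eigenspaces h b (g.separatingLeft x) hc hK
    have htop : g.ClD x = ⊤ := if_pos h
    exact ⟨h1, fun W hW ↦ h2 W fun a ↦ hW ⟨a, htop ▸ Algebra.mem_top⟩⟩

theorem commute_chartVolume (hm : 1 ≤ m) (g : PseudoRiemannianMetric m M)
    (he : e ∈ IsManifold.maximalAtlas (𝓡 m) ∞ M) {x : M} (hx : x ∈ e.source) (a : g.ClD x) :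
    Commute (a : g.Cl x) (chartVolume g e x) := by
  obtain ⟨b, hb⟩ := exists_basis_chartFrame he hx
  have hvol : chartVolume g e x = cliffordVolume (g.quadraticForm x) m b := by
    rw [chartVolume]
    congr 1
    exact (funext hb).symm
  rw [hvol]
  rcases Nat.even_or_odd m with h | h
  · have hE : g.ClD x = CliffordAlgebra.even (g.quadraticForm x) :=
      if_neg (Nat.not_odd_iff_even.2 h)
    exact commute_cliffordVolume_of_mem_even h hm b (g.separatingLeft x) (hE.le a.2)
  · exact commute_cliffordVolume_of_odd h b (g.separatingLeft x) a

theorem exists_chartVolume_mul_self (g : PseudoRiemannianMetric m M)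
    (he : e ∈ IsManifold.maximalAtlas (𝓡 m) ∞ M) {x : M} (hx : x ∈ e.source) :
    ∃ r : ℝ, r ≠ 0 ∧ chartVolume g e x * chartVolume g e x = algebraMap ℝ _ r := by
  obtain ⟨b, hb⟩ := exists_basis_chartFrame he hx
  have hvol : chartVolume g e x = cliffordVolume (g.quadraticForm x) m b := by
    rw [chartVolume]
    congr 1
    exact (funext hb).symm
  rw [hvol]
  exact cliffordVolume_mul_self b (g.separatingLeft x)

end ChartFrames

/-! ### Smooth sections of complex vector bundles -/

section SmoothSections

variable {m : ℕ} {M : Type*} [TopologicalSpace M] [ChartedSpace (EuclideanSpace ℝ (Fin m)) M]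
  {F : Type*} [NormedAddCommGroup F] [NormedSpace ℂ F]
  {E : M → Type*}
  [∀ x, TopologicalSpace (E x)] [TopologicalSpace (TotalSpace F E)] [FiberBundle F E]

theorem IsSmoothSectionOn.mono {s : ∀ x, E x} {U U' : Set M} (hs : IsSmoothSectionOn m F s U)
    (h : U' ⊆ U) : IsSmoothSectionOn m F s U' :=
  ContMDiffOn.mono hs h

theorem IsSmoothSectionOn.congr {s t : ∀ x, E x} {U : Set M} (hs : IsSmoothSectionOn m F s U)
    (h : ∀ x ∈ U, t x = s x) : IsSmoothSectionOn m F t U :=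
  ContMDiffOn.congr hs fun x hx ↦ by rw [h x hx]

/-- Every vector of a fibre extends to a local smooth section. -/
theorem exists_isSmoothSectionOn_apply_eq [∀ x, AddCommGroup (E x)] [∀ x, Module ℂ (E x)]
    [VectorBundle ℝ F E] [ContMDiffVectorBundle ∞ F E (𝓡 m)] {x₀ : M} (v : E x₀) :
    ∃ U : Set M, IsOpen U ∧ x₀ ∈ U ∧ ∃ s : ∀ x, E x, IsSmoothSectionOn m F s U ∧ s x₀ = v := by
  set e := trivializationAt F E x₀
  have hb : x₀ ∈ e.baseSet := FiberBundle.mem_baseSet_trivializationAt' x₀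
  refine ⟨e.baseSet, e.open_baseSet, hb, fun x ↦ e.symm x (e ⟨x₀, v⟩).2, ?_, ?_⟩
  · refine (Trivialization.contMDiffOn_section_iff (IB := 𝓡 m) (n := ∞) (𝕜 := ℝ) e
      e.open_baseSet subset_rfl).2 ?_
    refine (contMDiffOn_const (c := (e ⟨x₀, v⟩).2)).congr fun x hx ↦ ?_
    rw [e.apply_mk_symm hx]
  · exact e.symm_proj_apply ⟨x₀, v⟩ hb

variable [∀ x, AddCommGroup (E x)] [∀ x, Module ℂ (E x)] [VectorBundle ℂ F E]

theorem IsSmoothSectionOn.smul {f : M → ℂ} {s : ∀ x, E x} {U : Set M}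
    (hf : ContMDiffOn (𝓡 m) 𝓘(ℝ, ℂ) ∞ f U) (hs : IsSmoothSectionOn m F s U) :
    IsSmoothSectionOn m F (fun x ↦ f x • s x) U := by
  intro x₀ hx₀
  have hs' := hs x₀ hx₀
  rw [contMDiffWithinAt_section] at hs' ⊢
  set e := trivializationAt F E x₀
  have h1 : ContMDiff 𝓘(ℝ, ℂ × F) 𝓘(ℝ, F) ∞ fun p : ℂ × F ↦ p.1 • p.2 :=
    contDiff_smul.contMDiff
  refine (h1.contMDiffAt.comp_contMDiffWithinAt x₀
    ((hf x₀ hx₀).prodMk_space hs')).congr_of_eventuallyEq ?_ ?_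
  · filter_upwards [mem_nhdsWithin_of_mem_nhds
      (e.open_baseSet.mem_nhds <| mem_baseSet_trivializationAt F E x₀)] with x hx
    exact (e.linear ℂ hx).2 _ _
  · exact (e.linear ℂ (FiberBundle.mem_baseSet_trivializationAt' x₀)).2 _ _

/-- The quotient of two proportional smooth sections is a smooth function. -/
theorem contMDiffAt_of_smooth_smul {f : M → ℂ} {s t : ∀ x, E x} {U : Set M} (hU : IsOpen U)
    (hs : IsSmoothSectionOn m F s U) (ht : IsSmoothSectionOn m F t U)
    (hst : ∀ x ∈ U, t x = f x • s x) {x₀ : M} (hx₀ : x₀ ∈ U) (h0 : s x₀ ≠ 0) :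
    ContMDiffAt (𝓡 m) 𝓘(ℝ, ℂ) ∞ f x₀ := by
  have hs' := (hs x₀ hx₀).contMDiffAt (hU.mem_nhds hx₀)
  have ht' := (ht x₀ hx₀).contMDiffAt (hU.mem_nhds hx₀)
  rw [contMDiffAt_section] at hs' ht'
  set e := trivializationAt F E x₀
  have hb : x₀ ∈ e.baseSet := FiberBundle.mem_baseSet_trivializationAt' x₀
  have h1 : (e ⟨x₀, s x₀⟩).2 ≠ 0 := fun h ↦ h0 <| by
    have := (e.linearEquivAt ℂ x₀ hb).map_eq_zero_iff (x := s x₀)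
    exact this.1 h
  -- A functional that does not vanish on `s x₀` expresses `f` near `x₀` as a quotient of two smooth
  -- scalar functions.
  obtain ⟨l, -, hl⟩ := exists_dual_vector ℂ _ (norm_ne_zero_iff.2 h1)
  have hl0 : l (e ⟨x₀, s x₀⟩).2 ≠ 0 := by
    rw [hl]
    simpa using h1
  have hls : ∀ u : ∀ x, E x, ContMDiffAt (𝓡 m) 𝓘(ℝ, F) ∞ (fun x ↦ (e ⟨x, u x⟩).2) x₀ →
      ContMDiffAt (𝓡 m) 𝓘(ℝ, ℂ) ∞ (fun x ↦ l (e ⟨x, u x⟩).2) x₀ := fun u hu ↦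
    ((l.restrictScalars ℝ).contDiff.contMDiff.contMDiffAt).comp x₀ hu
  have hinv : ContMDiffAt 𝓘(ℝ, ℂ) 𝓘(ℝ, ℂ) ∞ (fun z : ℂ ↦ z⁻¹) (l (e ⟨x₀, s x₀⟩).2) :=
    (contDiffAt_inv ℝ hl0).contMDiffAt
  have hmul : ContMDiff 𝓘(ℝ, ℂ × ℂ) 𝓘(ℝ, ℂ) ∞ fun p : ℂ × ℂ ↦ p.1 * p.2 :=
    contDiff_mul.contMDiff
  have h2 := hmul.contMDiffAt.comp x₀ ((hls t ht').prodMk_space (hinv.comp x₀ (hls s hs')))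
  refine h2.congr_of_eventuallyEq ?_
  filter_upwards [hU.mem_nhds hx₀, e.open_baseSet.mem_nhds hb,
    (hls s hs').continuousAt.eventually_ne hl0] with x hxU hxb hxl
  have : (e ⟨x, t x⟩).2 = f x • (e ⟨x, s x⟩).2 := by
    rw [hst x hxU]
    exact (e.linear ℂ hxb).2 _ _
  simp only [Function.comp_apply, this, map_smul, smul_eq_mul]
  rw [mul_assoc, mul_inv_cancel₀ hxl, mul_one]

/-- Sections that are smooth near `x₀`, linearly independent at `x₀`, and take values in a family
of subspaces of the right dimension, are a local frame of that family. -/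
theorem exists_open_linearIndependent_span_eq {p : ℕ} {s : Fin p → ∀ x, E x} {U : Set M}
    (hU : IsOpen U) (hs : ∀ i, IsSmoothSectionOn m F (s i) U) {x₀ : M} (hx₀ : x₀ ∈ U)
    (hli : LinearIndependent ℂ fun i ↦ s i x₀) {W : ∀ x, Submodule ℂ (E x)}
    (hW : ∀ i, ∀ x ∈ U, s i x ∈ W x) (hp : 0 < p) (hdim : ∀ x ∈ U, finrank ℂ (W x) = p) :
    ∃ U' : Set M, IsOpen U' ∧ x₀ ∈ U' ∧ U' ⊆ U ∧ ∀ x ∈ U', LinearIndependent ℂ (fun i ↦ s i x) ∧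
      Submodule.span ℂ (Set.range fun i ↦ s i x) = W x := by
  set e := trivializationAt F E x₀
  have hb : x₀ ∈ e.baseSet := FiberBundle.mem_baseSet_trivializationAt' x₀
  have hcont : ContinuousAt (fun x ↦ fun i ↦ (e ⟨x, s i x⟩).2) x₀ := by
    rw [continuousAt_pi]
    intro i
    have := (hs i x₀ hx₀).contMDiffAt (hU.mem_nhds hx₀)
    rw [contMDiffAt_section] at this
    exact this.continuousAt
  have hiff : ∀ x ∈ e.baseSet, (LinearIndependent ℂ (fun i ↦ (e ⟨x, s i x⟩).2) ↔
      LinearIndependent ℂ fun i ↦ s i x) := fun x hx ↦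
    LinearMap.linearIndependent_iff (e.linearEquivAt ℂ x hx : E x →ₗ[ℂ] F)
      (LinearEquiv.ker _) (v := fun i ↦ s i x)
  -- Linear independence of finitely many vectors is an open condition in the fixed fibre `F`.
  have hev : ∀ᶠ x in nhds x₀, LinearIndependent ℂ (fun i ↦ (e ⟨x, s i x⟩).2) :=
    hcont.eventually ((hiff x₀ hb).2 hli).eventually
  obtain ⟨U', hU', hopen, hmem⟩ := eventually_nhds_iff.1
    (hev.and ((hU.eventually_mem hx₀).and
      (e.open_baseSet.eventually_mem hb)))
  refine ⟨U', hopen, hmem, fun x hx ↦ (hU' x hx).2.1, fun x hx ↦ ?_⟩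
  obtain ⟨h1, h2, h3⟩ := hU' x hx
  have hli' := (hiff x h3).1 h1
  refine ⟨hli', ?_⟩
  have hle : Submodule.span ℂ (Set.range fun i ↦ s i x) ≤ W x := by
    rw [Submodule.span_le]
    rintro _ ⟨i, rfl⟩
    exact hW i x h2
  have : FiniteDimensional ℂ (W x) := Module.finite_of_finrank_pos (by rw [hdim x h2]; exact hp)
  refine Submodule.eq_of_le_of_finrank_eq hle ?_
  rw [finrank_span_eq_card hli', hdim x h2, Fintype.card_fin]

variable [VectorBundle ℝ F E] [IsManifold (𝓡 m) ∞ M]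

variable {g : PseudoRiemannianMetric m M} (τ : CliffordModuleStructure F E g)
  {e : OpenPartialHomeomorph M (EuclideanSpace ℝ (Fin m))}

/-- The volume element of a chart maps smooth sections to smooth sections. -/
theorem CliffordModuleStructure.isSmoothSectionOn_chartVolume
    (he : e ∈ IsManifold.maximalAtlas (𝓡 m) ∞ M) {s : ∀ x, E x} {U : Set M} (hU : IsOpen U)
    (hUe : U ⊆ e.source) (hs : IsSmoothSectionOn m F s U) :
    IsSmoothSectionOn m F (fun x ↦ τ.hom x (chartVolume g e x) (s x)) U := by
  set b := (EuclideanSpace.basisFun (Fin m) ℝ).toBasis with hb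
  -- Smoothness of `τ` is assumed only for vector fields, so products are handled one factor at a
  -- time.
  have hlist : ∀ l : List (Fin m), IsSmoothSectionOn m F (fun x ↦ τ.hom x
      (l.map fun i ↦ CliffordAlgebra.ι (g.quadraticForm x) (chartFrame e x (b i))).prod (s x))
      U := by
    intro l
    induction l with
    | nil => simpa using hs
    | cons i l ih =>
      simp only [List.map_cons, List.prod_cons, map_mul, Module.End.mul_apply]
      exact τ.smooth U hU _ _ (ContMDiffOn.mono (contMDiffOn_chartFrame he (b i)) hUe) ih
  have hterm : ∀ σ : Equiv.Perm (Fin m), IsSmoothSectionOn m F (fun x ↦ τ.hom x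
      (Equiv.Perm.sign σ • (List.ofFn fun i ↦
        CliffordAlgebra.ι (g.quadraticForm x) (chartFrame e x (b (σ i)))).prod) (s x)) U := by
    intro σ
    have h := hlist (List.ofFn σ)
    simp only [List.map_ofFn, Function.comp_def] at h
    rcases Int.units_eq_one_or (Equiv.Perm.sign σ) with hσ | hσ
    · simpa [hσ] using h
    · refine (IsSmoothSectionOn.smul (contMDiffOn_const (c := (-1 : ℂ))) h).congr fun x _ ↦ ?_
      simp [hσ]
  have hsum := ContMDiffOn.sum_section (I := 𝓡 m) (n := ∞) (F := F) (u := U) (s := Finset.univ)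
    fun σ _ ↦ hterm σ
  refine IsSmoothSectionOn.congr hsum fun x _ ↦ ?_
  rw [chartVolume, cliffordVolume_apply, map_sum, LinearMap.sum_apply]

end SmoothSections

/-! ### Square roots of real numbers -/

section SquareRoot

/-- A complex square root of a real number that is smooth away from zero. -/
def smoothSqrt (r : ℝ) : ℂ := if 0 < r then (√r : ℂ) else Complex.I * (√(-r) : ℂ)

theorem smoothSqrt_sq (r : ℝ) : smoothSqrt r ^ 2 = r := by
  unfold smoothSqrt
  split_ifs with h
  · rw [← Complex.ofReal_pow, Real.sq_sqrt h.le]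
  · rw [mul_pow, Complex.I_sq, ← Complex.ofReal_pow, Real.sq_sqrt (by linarith)]
    simp

theorem smoothSqrt_ne_zero {r : ℝ} (hr : r ≠ 0) : smoothSqrt r ≠ 0 := fun h ↦ by
  have := smoothSqrt_sq r
  rw [h] at this
  exact hr (by exact_mod_cast (by simpa using this.symm : (r : ℂ) = 0))

/-- This is where orientation enters the choice of root: a positive Jacobian carries the chosen root
to the chosen root, whereas for negative `d` the sign would flip. -/
theorem smoothSqrt_sq_mul {d : ℝ} (hd : 0 < d) (r : ℝ) :
    smoothSqrt (d ^ 2 * r) = d * smoothSqrt r := by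
  have h : 0 < d ^ 2 * r ↔ 0 < r := mul_pos_iff_of_pos_left (by positivity)
  unfold smoothSqrt
  simp only [h]
  split_ifs
  · rw [Real.sqrt_mul (by positivity), Real.sqrt_sq hd.le, Complex.ofReal_mul]
  · rw [← mul_neg, Real.sqrt_mul (by positivity), Real.sqrt_sq hd.le, Complex.ofReal_mul]
    ring

theorem contDiffAt_smoothSqrt {r : ℝ} (hr : r ≠ 0) : ContDiffAt ℝ ∞ smoothSqrt r := by
  have hof : ContDiff ℝ ∞ (fun x : ℝ ↦ (x : ℂ)) := Complex.ofRealCLM.contDiff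
  rcases hr.lt_or_gt with h | h
  · have h1 : ContDiffAt ℝ ∞ (fun x : ℝ ↦ Complex.I * (√(-x) : ℂ)) r :=
      contDiffAt_const.mul (hof.contDiffAt.comp r (contDiffAt_id.neg.sqrt (by simpa using hr)))
    refine h1.congr_of_eventuallyEq ?_
    filter_upwards [eventually_lt_nhds h] with x hx
    rw [smoothSqrt, if_neg hx.not_gt]
  · have h1 : ContDiffAt ℝ ∞ (fun x : ℝ ↦ (√x : ℂ)) r :=
      hof.contDiffAt.comp r (contDiffAt_id.sqrt hr)
    refine h1.congr_of_eventuallyEq ?_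
    filter_upwards [eventually_gt_nhds h] with x hx
    rw [smoothSqrt, if_pos hx]

/-- A square root of a nonzero real number is real or purely imaginary, so that the sum of its
real and imaginary parts does not vanish. -/
theorem re_add_im_ne_zero_of_sq_eq {d : ℂ} {r : ℝ} (hr : r ≠ 0) (h : d ^ 2 = r) :
    d.re + d.im ≠ 0 := fun h0 ↦ by
  have h1 := congrArg Complex.im h
  have h2 := congrArg Complex.re h
  simp only [sq, Complex.mul_im, Complex.mul_re, Complex.ofReal_im, Complex.ofReal_re] at h1 h2
  apply hr
  rw [← h2]
  linear_combination (d.re - d.im) * h0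

end SquareRoot

/-! ### The square of the volume element -/

section ChartSquare

variable {m : ℕ} {M : Type*} [TopologicalSpace M] [ChartedSpace (EuclideanSpace ℝ (Fin m)) M]
  [IsManifold (𝓡 m) ∞ M] (g : PseudoRiemannianMetric m M)
  {e e' : OpenPartialHomeomorph M (EuclideanSpace ℝ (Fin m))}

/-- The real number that is the square of the volume element of a chart. -/
def chartSquare (e : OpenPartialHomeomorph M (EuclideanSpace ℝ (Fin m))) (x : M) : ℝ :=
  -- The value matters only for `x` in the source of a chart of the maximal atlas, where the square
  -- is known to be a real scalar.
  Function.invFun (algebraMap ℝ (g.Cl x)) (chartVolume g e x * chartVolume g e x)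

variable {g}

theorem chartVolume_mul_self (he : e ∈ IsManifold.maximalAtlas (𝓡 m) ∞ M) {x : M}
    (hx : x ∈ e.source) :
    chartVolume g e x * chartVolume g e x = algebraMap ℝ _ (chartSquare g e x) := by
  obtain ⟨r, -, hr⟩ := exists_chartVolume_mul_self g he hx
  exact (Function.invFun_eq ⟨r, hr.symm⟩).symm

theorem chartSquare_ne_zero (he : e ∈ IsManifold.maximalAtlas (𝓡 m) ∞ M) {x : M}
    (hx : x ∈ e.source) : chartSquare g e x ≠ 0 := by
  obtain ⟨r, hr0, hr⟩ := exists_chartVolume_mul_self g he hx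
  rw [chartVolume_mul_self he hx] at hr
  rwa [(algebraMap ℝ (g.Cl x)).injective hr]

theorem chartSquare_eq (he : e ∈ IsManifold.maximalAtlas (𝓡 m) ∞ M)
    (he' : e' ∈ IsManifold.maximalAtlas (𝓡 m) ∞ M) {x : M} (hx : x ∈ e.source)
    (hx' : x ∈ e'.source) : chartSquare g e x =
      (fderiv ℝ (e.symm.trans e') (e x)).det ^ 2 * chartSquare g e' x := by
  apply (algebraMap ℝ (g.Cl x)).injective
  rw [← chartVolume_mul_self he hx, chartVolume_eq_det_smul g he he' hx hx', smul_mul_smul_comm,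
    chartVolume_mul_self he' hx', Algebra.smul_def, ← map_mul, sq]

variable {F : Type*} [NormedAddCommGroup F] [NormedSpace ℂ F]
  {E : M → Type*} [∀ x, AddCommGroup (E x)] [∀ x, Module ℂ (E x)]
  [∀ x, TopologicalSpace (E x)] [TopologicalSpace (TotalSpace F E)] [FiberBundle F E]
  {τ : CliffordModuleStructure F E g}

variable (τ) in
theorem hom_chartVolume_mul_self (he : e ∈ IsManifold.maximalAtlas (𝓡 m) ∞ M) {x : M}
    (hx : x ∈ e.source) : τ.hom x (chartVolume g e x) * τ.hom x (chartVolume g e x) =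
      ((chartSquare g e x : ℝ) : ℂ) • 1 := by
  rw [← map_mul, chartVolume_mul_self he hx, AlgHom.commutes]
  ext s
  simp [Module.algebraMap_end_apply]

/-- For `m = 2n` and for `m = 2n - 1` alike, `(m + 1) / 2` is `n`, so the rank is half of `2 ^ n`.
-/
theorem CliffordModuleStructure.IsSpinorBundle.finrank_eigenspace (hm : 1 ≤ m)
    (hτ : τ.IsSpinorBundle) (he : e ∈ IsManifold.maximalAtlas (𝓡 m) ∞ M) {x : M}
    (hx : x ∈ e.source) {c : ℂ} (hc : c ^ 2 = chartSquare g e x) :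
    finrank ℂ (Module.End.eigenspace (τ.hom x (chartVolume g e x)) c) =
      2 ^ ((m + 1) / 2 - 1) := by
  have hc0 : c ≠ 0 := by
    rintro rfl
    exact chartSquare_ne_zero (g := g) he hx (by exact_mod_cast (by simpa using hc.symm))
  have h := (hτ.chartVolume_eigenspaces hm he hx hc0
    (by rw [hc]; exact hom_chartVolume_mul_self τ he hx)).1
  rw [show (m + 1) / 2 = ((m + 1) / 2 - 1) + 1 by omega, pow_succ] at h
  omega

variable [VectorBundle ℂ F E] [VectorBundle ℝ F E] [ContMDiffVectorBundle ∞ F E (𝓡 m)]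

/-- Applying the volume element twice to a smooth section multiplies it by `chartSquare`. Near a
point where the section is nonzero, the factor is a quotient of proportional smooth sections, so no
formula in metric coefficients is needed. -/
theorem CliffordModuleStructure.IsSpinorBundle.contMDiffAt_chartSquare (hm : 1 ≤ m)
    (hτ : τ.IsSpinorBundle) (he : e ∈ IsManifold.maximalAtlas (𝓡 m) ∞ M) {x : M}
    (hx : x ∈ e.source) : ContMDiffAt (𝓡 m) 𝓘(ℝ, ℝ) ∞ (chartSquare g e) x := by
  have hfr := hτ.finrank_eigenspace hm he hx (smoothSqrt_sq _)
  obtain ⟨v, hv⟩ : ∃ v : E x, v ≠ 0 := by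
    by_contra! h
    have : Subsingleton (E x) := ⟨fun a b ↦ by rw [h a, h b]⟩
    rw [Module.finrank_zero_of_subsingleton] at hfr
    exact absurd hfr.symm (by positivity)
  obtain ⟨U, hU, hxU, s, hs, hsv⟩ := exists_isSmoothSectionOn_apply_eq (m := m) (F := F) v
  have hU' := hU.inter e.open_source
  have hs' := hs.mono (inter_subset_left (t := e.source))
  have h1 := τ.isSmoothSectionOn_chartVolume he hU' inter_subset_right hs'
  have h2 := τ.isSmoothSectionOn_chartVolume he hU' inter_subset_right h1
  have h3 := contMDiffAt_of_smooth_smul (f := fun x ↦ (chartSquare g e x : ℂ)) hU' hs' h2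
    (fun y hy ↦ LinearMap.congr_fun (hom_chartVolume_mul_self τ he hy.2) (s y)) ⟨hxU, hx⟩
    (by rwa [hsv])
  exact Complex.reCLM.contDiff.contMDiff.contMDiffAt.comp x h3

end ChartSquare

/-! ### Reversing the orientation of a chart -/

section Reflection

variable {m : ℕ} {M : Type*} [TopologicalSpace M] [ChartedSpace (EuclideanSpace ℝ (Fin m)) M]

/-- Every chart in positive dimension can be composed with a reflection. -/
theorem exists_chart_det_neg (hm : 1 ≤ m)
    {e : OpenPartialHomeomorph M (EuclideanSpace ℝ (Fin m))}
    (he : e ∈ IsManifold.maximalAtlas (𝓡 m) ∞ M) {x : M} (hx : x ∈ e.source) :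
    ∃ e' ∈ IsManifold.maximalAtlas (𝓡 m) ∞ M, x ∈ e'.source ∧
      (fderiv ℝ (e.symm.trans e') (e x)).det < 0 := by
  -- The reflection in the hyperplane orthogonal to the first coordinate vector has determinant -1.
  let v : EuclideanSpace ℝ (Fin m) := EuclideanSpace.single ⟨0, hm⟩ 1
  have hv : v ≠ 0 := by simp [v]
  let R : EuclideanSpace ℝ (Fin m) ≃ₗᵢ[ℝ] EuclideanSpace ℝ (Fin m) :=
    (Submodule.span ℝ {v})ᗮ.reflection
  have hR : LinearMap.det R.toLinearMap = -1 := by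
    rw [Submodule.det_reflection, Submodule.orthogonal_orthogonal, finrank_span_singleton hv,
      pow_one]
  let f : OpenPartialHomeomorph (EuclideanSpace ℝ (Fin m)) (EuclideanSpace ℝ (Fin m)) :=
    R.toHomeomorph.toOpenPartialHomeomorph
  have hf : f ∈ contDiffGroupoid ∞ (𝓡 m) := by
    rw [contDiffGroupoid, mem_groupoid_of_pregroupoid]
    exact ⟨R.contDiff.contDiffOn, R.symm.contDiff.contDiffOn⟩
  have he' : e.trans f ∈ IsManifold.maximalAtlas (𝓡 m) ∞ M := by
    intro e₁ he₁
    obtain ⟨h1, h2⟩ := he e₁ he₁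
    refine ⟨?_, ?_⟩
    · rw [OpenPartialHomeomorph.trans_symm_eq_symm_trans_symm, OpenPartialHomeomorph.trans_assoc]
      exact (contDiffGroupoid ∞ (𝓡 m)).trans ((contDiffGroupoid ∞ (𝓡 m)).symm hf) h1
    · rw [← OpenPartialHomeomorph.trans_assoc]
      exact (contDiffGroupoid ∞ (𝓡 m)).trans h2 hf
  refine ⟨e.trans f, he', by simp [hx, f], ?_⟩
  have h3 : (e.symm.trans (e.trans f)) =ᶠ[nhds (e x)] R := by
    filter_upwards [e.open_target.mem_nhds (e.map_source hx)] with y hy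
    simp [f, e.right_inv hy]
  have h4 : HasFDerivAt (e.symm.trans (e.trans f))
      (R.toContinuousLinearEquiv : _ →L[ℝ] _) (e x) :=
    (R.toContinuousLinearEquiv.hasFDerivAt (x := e x)).congr_of_eventuallyEq h3
  rw [h4.fderiv]
  change LinearMap.det R.toLinearMap < 0
  rw [hR]
  norm_num

end Reflection

/-! ### The main theorem -/

section Decomposition

variable {m : ℕ} {M : Type*} [TopologicalSpace M] [ChartedSpace (EuclideanSpace ℝ (Fin m)) M]
  [IsManifold (𝓡 m) ∞ M] {g : PseudoRiemannianMetric m M}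
  {F : Type*} [NormedAddCommGroup F] [NormedSpace ℂ F]
  {E : M → Type*} [∀ x, AddCommGroup (E x)] [∀ x, Module ℂ (E x)]
  [∀ x, TopologicalSpace (E x)] [TopologicalSpace (TotalSpace F E)] [FiberBundle F E]
  [VectorBundle ℂ F E] [VectorBundle ℝ F E]
  {τ : CliffordModuleStructure F E g}

theorem CliffordModuleStructure.IsSpinorBundle.orientable_of_isDecomposable (hm : 1 ≤ m)
    (hτ : τ.IsSpinorBundle) (hD : IsDecomposable m F E τ.homD) : IsOrientableManifold m M := by
  obtain ⟨p, q, Wp, Wm, hp, hq, hWp, hWm, hcompl, hinv, -⟩ := hD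
  have hne : ∀ {r : ℕ} (W : ∀ x, Submodule ℂ (E x)), 0 < r → IsSmoothSubbundle m F E r W →
      ∀ x, W x ≠ ⊥ := fun W hr hW x h ↦ by
    obtain ⟨U, -, hxU, s, -, hs⟩ := hW x
    obtain ⟨hli, hspan⟩ := hs x hxU
    refine hli.ne_zero ⟨0, hr⟩ ?_
    rw [← Submodule.mem_bot ℂ, ← h, ← hspan]
    exact Submodule.subset_span ⟨_, rfl⟩
  have hbot := hne Wp hp hWp
  have htop : ∀ x, Wp x ≠ ⊤ := fun x h ↦ hne Wm hq hWm x (by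
    have := (hcompl x).inf_eq_bot
    rwa [h, top_inf_eq] at this)
  have hex : ∀ e ∈ IsManifold.maximalAtlas (𝓡 m) ∞ M, ∀ x ∈ e.source, ∃ d : ℂ,
      d ^ 2 = chartSquare g e x ∧ ∀ s ∈ Wp x, τ.hom x (chartVolume g e x) s = d • s := by
    intro e he x hx
    obtain ⟨d, hd, h⟩ := (hτ.chartVolume_eigenspaces hm he hx
      (smoothSqrt_ne_zero (chartSquare_ne_zero he hx))
      (by rw [smoothSqrt_sq]; exact hom_chartVolume_mul_self τ he hx)).2 (Wp x) (hinv x)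
      (hbot x) (htop x)
    exact ⟨d, by rw [hd, smoothSqrt_sq], h⟩
  choose! w hw2 hw using hex
  -- the sign of the volume element on the subbundle
  set σ : OpenPartialHomeomorph M (EuclideanSpace ℝ (Fin m)) → M → ℝ :=
    fun e x ↦ (w e x).re + (w e x).im with hσ
  have hσ0 : ∀ e ∈ IsManifold.maximalAtlas (𝓡 m) ∞ M, ∀ x ∈ e.source, σ e x ≠ 0 :=
    fun e he x hx ↦ re_add_im_ne_zero_of_sq_eq (chartSquare_ne_zero he hx) (hw2 e he x hx)
  have huniq : ∀ x (d d' : ℂ), (∀ s ∈ Wp x, d • s = d' • s) → d = d' := fun x d d' h ↦ by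
    obtain ⟨s, hs, hs0⟩ := Submodule.exists_mem_ne_zero_of_ne_bot (hbot x)
    exact smul_left_injective ℂ hs0 (h s hs)
  have hσtrans : ∀ e ∈ IsManifold.maximalAtlas (𝓡 m) ∞ M,
      ∀ e' ∈ IsManifold.maximalAtlas (𝓡 m) ∞ M, ∀ x ∈ e.source, x ∈ e'.source →
      σ e x = (fderiv ℝ (e.symm.trans e') (e x)).det * σ e' x := by
    intro e he e' he' x hx hx'
    set d := (fderiv ℝ (e.symm.trans e') (e x)).det with hd
    have h : w e x = d * w e' x := huniq x _ _ fun s hs ↦ by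
      rw [← hw e he x hx s hs, chartVolume_eq_det_smul g he he' hx hx', map_smul, ← hd, mul_smul,
        ← hw e' he' x hx' s hs, Complex.coe_smul]
      rfl
    simp only [hσ, h, Complex.mul_re, Complex.mul_im, Complex.ofReal_re, Complex.ofReal_im]
    ring
  have hσcont : ∀ e ∈ IsManifold.maximalAtlas (𝓡 m) ∞ M, ContinuousOn (σ e) e.source := by
    intro e he x hx
    obtain ⟨U, hU, hxU, s, hs, hsW⟩ := hWp x
    have hU' := hU.inter e.open_source
    have hs' := (hs ⟨0, hp⟩).mono (inter_subset_left (t := e.source))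
    have h := contMDiffAt_of_smooth_smul (f := w e) hU' hs'
      (τ.isSmoothSectionOn_chartVolume he hU' inter_subset_right hs') (fun y hy ↦
        hw e he y hy.2 _ ((hsW y hy.1).2 ▸ Submodule.subset_span ⟨_, rfl⟩)) ⟨hxU, hx⟩
      ((hsW x hxU).1.ne_zero _)
    exact ((Complex.continuous_re.continuousAt.comp h.continuousAt).add
      (Complex.continuous_im.continuousAt.comp h.continuousAt)).continuousWithinAt
  -- On overlaps `σ e = det * σ e'` with both values positive, which forces a positive Jacobian.
  refine ⟨{e | e ∈ IsManifold.maximalAtlas (𝓡 m) ∞ M ∧ ∀ x ∈ e.source, 0 < σ e x},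
    fun e he ↦ he.1, fun x ↦ ?_, ?_⟩
  · obtain ⟨e, he, hx, hpos⟩ : ∃ e ∈ IsManifold.maximalAtlas (𝓡 m) ∞ M,
        x ∈ e.source ∧ 0 < σ e x := by
      have he := IsManifold.chart_mem_maximalAtlas (I := 𝓡 m) (n := ∞) x
      have hx := mem_chart_source (EuclideanSpace ℝ (Fin m)) x
      rcases (hσ0 _ he x hx).lt_or_gt with hlt | hgt
      · obtain ⟨e', he', hx', hdet⟩ := exists_chart_det_neg hm he hx
        refine ⟨e', he', hx', ?_⟩
        have := hσtrans _ he e' he' x hx hx'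
        rw [this] at hlt
        exact pos_of_mul_neg_right hlt hdet.le
      · exact ⟨_, he, hx, hgt⟩
    -- Positivity at `x` persists on an open set, to which the chart is restricted.
    have hopen := (hσcont e he).isOpen_inter_preimage e.open_source (isOpen_Ioi (a := (0 : ℝ)))
    have he' := restr_mem_maximalAtlas (contDiffGroupoid ∞ (𝓡 m)) he hopen
    have hsub : (e.restr (e.source ∩ σ e ⁻¹' Ioi 0)).source = e.source ∩ σ e ⁻¹' Ioi 0 := by
      rw [e.restr_source' _ hopen, ← inter_assoc, inter_self]
    refine ⟨_, ⟨he', fun y hy ↦ ?_⟩, hsub.symm ▸ (⟨hx, hpos⟩ : x ∈ e.source ∩ σ e ⁻¹' Ioi 0)⟩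
    have hy' := hsub ▸ hy
    -- The scalar was chosen separately for the restricted chart, but both charts have the same
    -- volume element at `y`, and its eigenvalue on `Wp y` is unique.
    have h : w (e.restr (e.source ∩ σ e ⁻¹' Ioi 0)) y = w e y := huniq y _ _ fun s hs ↦ by
      rw [← hw _ he' y hy s hs, ← hw e he y hy'.1 s hs]
      rfl
    change 0 < (w _ y).re + (w _ y).im
    rw [h]
    exact hy'.2
  · rintro e ⟨he, hepos⟩ e' ⟨he', hepos'⟩ y hy
    rw [OpenPartialHomeomorph.trans_source, OpenPartialHomeomorph.symm_source] at hy
    have hx : e.symm y ∈ e.source := e.map_target hy.1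
    have h := hσtrans e he e' he' _ hx hy.2
    rw [e.right_inv hy.1] at h
    have h1 := hepos _ hx
    rw [h] at h1
    exact pos_of_mul_pos_left h1 (hepos' _ hy.2).le

variable [ContMDiffVectorBundle ∞ F E (𝓡 m)]

/-- A family of subspaces that is locally an eigenspace of the volume element of a chart is a
smooth subbundle. -/
theorem CliffordModuleStructure.IsSpinorBundle.isSmoothSubbundle_eigenspace (hm : 1 ≤ m)
    (hτ : τ.IsSpinorBundle) {A : Set (OpenPartialHomeomorph M (EuclideanSpace ℝ (Fin m)))}
    (hA : A ⊆ IsManifold.maximalAtlas (𝓡 m) ∞ M) (hcov : ∀ x : M, ∃ e ∈ A, x ∈ e.source)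
    {W : ∀ x, Submodule ℂ (E x)} {δ : ℂ} (hδ : δ ^ 2 = 1)
    (hW : ∀ e ∈ A, ∀ x ∈ e.source, W x =
      Module.End.eigenspace (τ.hom x (chartVolume g e x)) (δ * smoothSqrt (chartSquare g e x))) :
    IsSmoothSubbundle m F E (2 ^ ((m + 1) / 2 - 1)) W := by
  intro x₀
  obtain ⟨e, heA, hx₀⟩ := hcov x₀
  have he := hA heA
  set c : M → ℂ := fun x ↦ δ * smoothSqrt (chartSquare g e x) with hc
  have hc2 : ∀ x, c x ^ 2 = chartSquare g e x := fun x ↦ by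
    rw [hc, mul_pow, hδ, one_mul, smoothSqrt_sq]
  have hc0 : ∀ x ∈ e.source, c x ≠ 0 := fun x hx h ↦ by
    have := hc2 x
    rw [h] at this
    exact chartSquare_ne_zero (g := g) he hx (by exact_mod_cast (by simpa using this.symm))
  have hcs : ∀ x ∈ e.source, ContMDiffAt (𝓡 m) 𝓘(ℝ, ℂ) ∞ (fun x ↦ (c x)⁻¹) x := fun x hx ↦ by
    have h1 : ContDiffAt ℝ ∞ (fun r ↦ (δ * smoothSqrt r)⁻¹) (chartSquare g e x) :=
      (contDiffAt_const.mul (contDiffAt_smoothSqrt (chartSquare_ne_zero he hx))).inv (hc0 x hx)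
    exact h1.contMDiffAt.comp x (hτ.contMDiffAt_chartSquare hm he hx)
  have hdim : ∀ x ∈ e.source, finrank ℂ (W x) = 2 ^ ((m + 1) / 2 - 1) := fun x hx ↦ by
    rw [hW e heA x hx]
    exact hτ.finrank_eigenspace hm he hx (hc2 x)
  have : FiniteDimensional ℂ (W x₀) :=
    Module.finite_of_finrank_pos (by rw [hdim x₀ hx₀]; positivity)
  let b : Basis (Fin (2 ^ ((m + 1) / 2 - 1))) ℂ (W x₀) := finBasisOfFinrankEq ℂ _ (hdim x₀ hx₀)
  choose U hU hxU s hs hsb using fun i ↦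
    exists_isSmoothSectionOn_apply_eq (m := m) (F := F) (b i : E x₀)
  set U₀ : Set M := (⋂ i, U i) ∩ e.source with hU₀
  have hU₀o : IsOpen U₀ := (isOpen_iInter_of_finite hU).inter e.open_source
  have hxU₀ : x₀ ∈ U₀ := ⟨mem_iInter.2 hxU, hx₀⟩
  have hsU : ∀ i, IsSmoothSectionOn m F (s i) U₀ := fun i ↦
    (hs i).mono fun x hx ↦ mem_iInter.1 hx.1 i
  -- With `K² = c²`, the operator `(1 + c⁻¹K) / 2` is the projection onto the `c`-eigenspace. It
  -- makes arbitrary smooth extensions of a basis of `W x₀` take values in `W` without changing them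
  -- at `x₀`.
  let t : Fin (2 ^ ((m + 1) / 2 - 1)) → ∀ x, E x := fun i x ↦
    (2⁻¹ : ℂ) • (s i x + (c x)⁻¹ • τ.hom x (chartVolume g e x) (s i x))
  have ht : ∀ i, IsSmoothSectionOn m F (t i) U₀ := fun i ↦ by
    have h1 := IsSmoothSectionOn.smul (f := fun x ↦ (c x)⁻¹)
      (fun x hx ↦ (hcs x hx.2).contMDiffWithinAt)
      (τ.isSmoothSectionOn_chartVolume he hU₀o inter_subset_right (hsU i))
    exact IsSmoothSectionOn.smul (contMDiffOn_const (c := (2⁻¹ : ℂ)))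
      (ContMDiffOn.add_section (hsU i) h1)
  have htW : ∀ i, ∀ x ∈ U₀, t i x ∈ W x := fun i x hx ↦ by
    rw [hW e heA x hx.2]
    refine Submodule.smul_mem _ _ (Module.End.mem_eigenspace_iff.2 ?_)
    have h1 := LinearMap.congr_fun (hom_chartVolume_mul_self τ he hx.2) (s i x)
    simp only [Module.End.mul_apply, LinearMap.smul_apply, Module.End.one_apply, ← hc2 x] at h1
    change _ = c x • _
    rw [map_add, map_smul, h1, smul_add, smul_smul, smul_smul, mul_inv_cancel₀ (hc0 x hx.2),
      one_smul, add_comm]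
    congr 2
    field_simp [hc0 x hx.2]
  have ht0 : ∀ i, t i x₀ = b i := fun i ↦ by
    have h1 := Module.End.mem_eigenspace_iff.1 ((hW e heA x₀ hx₀).le (b i).2)
    change (2⁻¹ : ℂ) • (s i x₀ + (c x₀)⁻¹ • τ.hom x₀ (chartVolume g e x₀) (s i x₀)) = _
    rw [hsb i, h1]
    change (2⁻¹ : ℂ) • ((b i : E x₀) + (c x₀)⁻¹ • c x₀ • (b i : E x₀)) = _
    rw [smul_smul, inv_mul_cancel₀ (hc0 x₀ hx₀), one_smul]
    module
  have hli : LinearIndependent ℂ fun i ↦ t i x₀ := by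
    simp only [ht0]
    exact b.linearIndependent.map' (W x₀).subtype (Submodule.ker_subtype _)
  obtain ⟨U', hU', hxU', hsub, h⟩ := exists_open_linearIndependent_span_eq hU₀o ht hxU₀ hli htW
    (by positivity) fun x hx ↦ hdim x hx.2
  exact ⟨U', hU', hxU', t, fun i ↦ (ht i).mono hsub, h⟩

theorem CliffordModuleStructure.IsSpinorBundle.isDecomposable_of_orientable (hm : 1 ≤ m)
    (hτ : τ.IsSpinorBundle) (hM : IsOrientableManifold m M) : IsDecomposable m F E τ.homD := by
  obtain ⟨A, hA, hcov, hpos⟩ := hM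
  choose a haA hax using hcov
  -- The charts `a x` are picked pointwise with no continuity. Passing to another chart of the
  -- oriented atlas rescales operator and eigenvalue by the same positive factor, so the eigenspace
  -- is unaffected.
  have key : ∀ δ : ℂ, ∀ e ∈ A, ∀ x ∈ e.source,
      Module.End.eigenspace (τ.hom x (chartVolume g (a x) x))
        (δ * smoothSqrt (chartSquare g (a x) x)) =
      Module.End.eigenspace (τ.hom x (chartVolume g e x))
        (δ * smoothSqrt (chartSquare g e x)) := by
    intro δ e he x hx
    have hd := hpos e he (a x) (haA x) (e x) (by simp [hx, e.left_inv hx, hax x])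
    set d := (fderiv ℝ (e.symm.trans (a x)) (e x)).det with hdd
    rw [chartSquare_eq (hA he) (hA (haA x)) hx (hax x),
      chartVolume_eq_det_smul g (hA he) (hA (haA x)) hx (hax x), ← hdd, smoothSqrt_sq_mul hd]
    ext s
    rw [Module.End.mem_eigenspace_iff, Module.End.mem_eigenspace_iff, map_smul, mul_left_comm,
      mul_smul (d : ℂ)]
    change _ ↔ d • τ.hom x (chartVolume g (a x) x) s = _
    rw [Complex.coe_smul]
    exact (smul_right_injective (E x) hd.ne').eq_iff.symm
  have hc0 : ∀ x, smoothSqrt (chartSquare g (a x) x) ≠ 0 := fun x ↦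
    smoothSqrt_ne_zero (chartSquare_ne_zero (hA (haA x)) (hax x))
  have hinv : ∀ δ : ℂ, ∀ x (u : g.ClD x),
      ∀ s ∈ Module.End.eigenspace (τ.hom x (chartVolume g (a x) x))
        (δ * smoothSqrt (chartSquare g (a x) x)), τ.homD x u s ∈
      Module.End.eigenspace (τ.hom x (chartVolume g (a x) x))
        (δ * smoothSqrt (chartSquare g (a x) x)) := fun δ x u s hs ↦
    (inf_eigenspace_invariant (W := ⊤)
      ((commute_chartVolume hm g (hA (haA x)) (hax x) u).map (τ.hom x))
      (fun _ _ ↦ trivial) _ s ⟨trivial, hs⟩).2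
  refine ⟨2 ^ ((m + 1) / 2 - 1), 2 ^ ((m + 1) / 2 - 1),
    fun x ↦ Module.End.eigenspace (τ.hom x (chartVolume g (a x) x))
      (1 * smoothSqrt (chartSquare g (a x) x)),
    fun x ↦ Module.End.eigenspace (τ.hom x (chartVolume g (a x) x))
      (-1 * smoothSqrt (chartSquare g (a x) x)), by positivity, by positivity, ?_, ?_, ?_,
    hinv 1, hinv (-1)⟩
  · exact hτ.isSmoothSubbundle_eigenspace hm hA (fun x ↦ ⟨a x, haA x, hax x⟩) (by norm_num) (key 1)
  · exact hτ.isSmoothSubbundle_eigenspace hm hA (fun x ↦ ⟨a x, haA x, hax x⟩) (by norm_num)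
      (key (-1))
  · intro x
    simp only [one_mul, neg_one_mul]
    refine isCompl_eigenspace_of_sq _ (hc0 x) ?_
    rw [smoothSqrt_sq]
    exact hom_chartVolume_mul_self τ (hA (haA x)) (hax x)

end Decomposition

end

theorem mainTheorem4 {m : ℕ} (hm : 1 ≤ m)
    {M : Type*} [TopologicalSpace M] [ChartedSpace (EuclideanSpace ℝ (Fin m)) M]
    [IsManifold (𝓡 m) ∞ M] [ConnectedSpace M]
    (g : PseudoRiemannianMetric m M)
    {F : Type*} [NormedAddCommGroup F] [NormedSpace ℂ F]
    {E : M → Type*} [∀ x, AddCommGroup (E x)] [∀ x, Module ℂ (E x)]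
    [∀ x, TopologicalSpace (E x)] [TopologicalSpace (TotalSpace F E)] [FiberBundle F E]
    [VectorBundle ℂ F E] [VectorBundle ℝ F E] [ContMDiffVectorBundle ∞ F E (𝓡 m)]
    (τ : CliffordModuleStructure F E g) (hτ : τ.IsSpinorBundle) :
    IsDecomposable m F E τ.homD ↔ IsOrientableManifold m M := by
  exact ⟨hτ.orientable_of_isDecomposable hm, hτ.isDecomposable_of_orientable hm⟩
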